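/- Let $n\ge 2$ and $1/2<\sigma<1$, put $p=\frac{2n}{n-2\sigma}$, and write $\mathbb{R}^n_+=\{x=(x',x_n)\in\mathbb{R}^{n-1}\times\mathbb{R}: x_n>0\}$. For real-valued measurable $u$ on $\mathbb{R}^n_+$ let $$I[u]=\iint_{\mathbb{R}^n_+\times\mathbb{R}^n_+}\frac{(u(x)-u(y))^2}{|x-y|^{n+2\sigma}}\,dx\,dy\in[0,\infty],$$ let $$S_{n,\sigma}(\mathbb{R}^n_+)=\inf\Big\{I[\varphi]:\ \varphi\in C_c^\infty(\mathbb{R}^n_+),\ \int_{\mathbb{R}^n_+}|\varphi|^{p}\,dx=1\Big\},$$ and let $\mathring H^\sigma(\mathbb{R}^n_+)$ be the completion of $C_c^\infty(\mathbb{R}^n_+)$ with respect to $I[\cdot]^{1/2}$, regarded as a space of functions in $L^p(\mathbb{R}^n_+)$: it consists of the measurable $u$ for which there are $\varphi_k\in C_c^\infty(\mathbb{R}^n_+)$ with $I[\varphi_k-u]\to0$ and $\int_{\mathbb{R}^n_+}|\varphi_k-u|^p\,dx\to0$. Let $u\in\mathring H^\sigma(\mathbb{R}^n_+)$ be a minimizer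 of $S_{n,\sigma}(\mathbb{R}^n_+)$, that is, $\int_{\mathbb{R}^n_+}|u|^p\,dx=1$ and $I[u]=S_{n,\sigma}(\mathbb{R}^n_+)$. Then $u$ is radially symmetric in the first $n-1$ variables about some point of $\mathbb{R}^{n-1}$: there are $a'\in\mathbb{R}^{n-1}$ and a function $v$ such that $u(x',x_n)=v(|x'-a'|,x_n)$ for almost every $(x',x_n)\in\mathbb{R}^n_+$. -/

import Mathlib

open MeasureTheory Filter Topology
open scoped ENNReal ContDiff

noncomputable section

namespace RegionalSobolev

/-- The critical exponent `2n / (n - 2σ)`. -/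
def critExp (n : ℕ) (σ : ℝ) : ℝ := 2 * (n : ℝ) / ((n : ℝ) - 2 * σ)

/-- The regional energy: the double integral over `Ω × Ω` of
`(u x - u y) ^ 2 / |x - y| ^ (n + 2σ)`, with values in `[0, ∞]`. -/
def energy {n : ℕ} (σ : ℝ) (Ω : Set (EuclideanSpace ℝ (Fin n)))
    (u : EuclideanSpace ℝ (Fin n) → ℝ) : ℝ≥0∞ :=
  ∫⁻ x in Ω, ∫⁻ y in Ω,
    ENNReal.ofReal ((u x - u y) ^ 2 / ‖x - y‖ ^ ((n : ℝ) + 2 * σ))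

/-- The integral over `Ω` of `|u| ^ (2n / (n - 2σ))`, with values in `[0, ∞]`. -/
def critMass {n : ℕ} (σ : ℝ) (Ω : Set (EuclideanSpace ℝ (Fin n)))
    (u : EuclideanSpace ℝ (Fin n) → ℝ) : ℝ≥0∞ :=
  ∫⁻ x in Ω, ENNReal.ofReal (|u x| ^ critExp n σ)

/-- Real-valued smooth functions with compact support contained in `Ω`. -/
def IsTestFunction {n : ℕ} (Ω : Set (EuclideanSpace ℝ (Fin n)))
    (φ : EuclideanSpace ℝ (Fin n) → ℝ) : Prop :=
  ContDiff ℝ ∞ φ ∧ HasCompactSupport φ ∧ tsupport φ ⊆ Ω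

/-- The sharp constant: the infimum of the energy over the test functions `φ` on `Ω` with
`∫_Ω |φ| ^ (2n / (n - 2σ)) = 1`. -/
def sharpConst {n : ℕ} (σ : ℝ) (Ω : Set (EuclideanSpace ℝ (Fin n))) : ℝ≥0∞ :=
  ⨅ (φ : EuclideanSpace ℝ (Fin n) → ℝ) (_ : IsTestFunction Ω φ) (_ : critMass σ Ω φ = 1),
    energy σ Ω φ

/-- Membership in the homogeneous space obtained by completing the test functions on `Ω` in the
norm `energy ^ (1/2)`, realized as a space of functions on `Ω`: when the sharp constant is
positive, a sequence of test functions that is Cauchy for the energy is Cauchy in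
`L ^ (2n / (n - 2σ))`, and the element of the completion that it represents is its limit there.
Only the values of `u` on `Ω`, up to null sets, matter. -/
def MemHomSobolev {n : ℕ} (σ : ℝ) (Ω : Set (EuclideanSpace ℝ (Fin n)))
    (u : EuclideanSpace ℝ (Fin n) → ℝ) : Prop :=
  AEMeasurable u (volume.restrict Ω) ∧
  ∃ φ : ℕ → EuclideanSpace ℝ (Fin n) → ℝ,
    (∀ k, IsTestFunction Ω (φ k)) ∧
    Tendsto (fun k => energy σ Ω (fun x => φ k x - u x)) atTop (𝓝 0) ∧
    Tendsto (fun k => critMass σ Ω (fun x => φ k x - u x)) atTop (𝓝 0)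

/-- `u` is a minimizer of the sharp constant of `Ω`. -/
def IsMinimizer {n : ℕ} (σ : ℝ) (Ω : Set (EuclideanSpace ℝ (Fin n)))
    (u : EuclideanSpace ℝ (Fin n) → ℝ) : Prop :=
  MemHomSobolev σ Ω u ∧ critMass σ Ω u = 1 ∧ energy σ Ω u = sharpConst σ Ω

/-- The last coordinate of a point of `ℝⁿ`, `n ≥ 2`. -/
def lastCoord {n : ℕ} (hn : 2 ≤ n) (x : EuclideanSpace ℝ (Fin n)) : ℝ :=
  x ⟨n - 1, by omega⟩

/-- The first `n - 1` coordinates, as a point of `ℝⁿ⁻¹` with the Euclidean norm. -/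
def firstCoords {n : ℕ} (x : EuclideanSpace ℝ (Fin n)) : EuclideanSpace ℝ (Fin (n - 1)) :=
  WithLp.toLp 2 fun i => x (Fin.castLE (Nat.sub_le n 1) i)

/-- The open upper half-space of `ℝⁿ`. -/
def halfSpace {n : ℕ} (hn : 2 ≤ n) : Set (EuclideanSpace ℝ (Fin n)) :=
  {x | 0 < lastCoord hn x}

end RegionalSobolev

end

/-!
Polarization at a vertical hyperplane `{y | ⟪e, y⟫ = t}` (`e` a horizontal unit vector) puts, of the
two values of a function at each pair of mirror points, the larger one on the positive side. It maps
functions on the half-space to functions on the half-space, preserves the `L ^ p` norm, and decreases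
the energy, because the kernel `|x - y| ^ (-(n + 2σ))` is larger for points on the same side than for
points on opposite sides. The decrease is an explicit integral, the integral of `gap`
(`four_mul_energy_polarize_add_le`), whose integrand is positive where `u - u ∘ planeRefl e t` takes
values of opposite signs at two points of the positive side.

For a minimizer `u` this integral vanishes (`IsMinimizer.lintegral_gap_eq_zero`). The polarization of
`u` itself is not used: test functions approximating `u` are polarized, which gives Lipschitz
functions with compact support, for which the Sobolev inequality holds by mollification
(`sharpConst_mul_le_of_lipschitz`), and Fatou's lemma passes to the limit in the gap. Hence `u` is
ordered with each of its mirror images, on each side of the mirror (`IsMinimizer.ae_le_or_ae_ge`);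
no sign of `u` is needed.

For a fixed `e`, the sets of `t` for which `u` lies above, respectively below, its mirror image on the
positive side are closed and cover the line. Neither is the whole line, since `u` is a nonzero
function in `L ^ p`. So they meet, and `u` is symmetric about some hyperplane orthogonal to `e`
(`exists_planeRefl_ae_eq`). The hyperplanes for the coordinate directions meet in a vertical line,
and `u` is symmetric under the horizontal point reflection at that line. Every other hyperplane of
symmetry contains the line, as otherwise `u` would be periodic, which a nonzero function in `L ^ p` is
not (`ae_eq_zero_of_add_eq`). So `u` is symmetric about each vertical hyperplane through the line, and
any two points with the same height and the same distance from the line are exchanged by such a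
reflection. Working with the limit of averages over balls (`preciseRep`) makes all these symmetries
hold at each point.
-/

noncomputable section

namespace RegionalSobolev

/-! ### Reflections in hyperplanes -/

section Reflection

variable {V : Type*} [NormedAddCommGroup V] [InnerProductSpace ℝ V]

/-- The signed height of `x` over the hyperplane `{y | ⟪e, y⟫ = t}`, for a unit vector `e`. -/
def height (e : V) (t : ℝ) (x : V) : ℝ := inner ℝ e x - t

/-- The reflection in the affine hyperplane `{y | ⟪e, y⟫ = t}`, for a unit vector `e`. -/
def planeRefl (e : V) (t : ℝ) (x : V) : V := x - (2 * height e t x) • e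

variable {e : V} {t : ℝ}

lemma height_planeRefl (he : ‖e‖ = 1) (x : V) : height e t (planeRefl e t x) = -height e t x := by
  simp only [height, planeRefl, inner_sub_right, inner_smul_right, real_inner_self_eq_norm_sq, he]
  ring

lemma planeRefl_planeRefl (he : ‖e‖ = 1) (x : V) : planeRefl e t (planeRefl e t x) = x := by
  rw [planeRefl, height_planeRefl he, planeRefl]
  module

lemma planeRefl_involutive (he : ‖e‖ = 1) : Function.Involutive (planeRefl e t) :=
  planeRefl_planeRefl he

lemma planeRefl_of_height_eq_zero {x : V} (hx : height e t x = 0) : planeRefl e t x = x := by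
  simp [planeRefl, hx]

lemma planeRefl_neg_neg (x : V) : planeRefl (-e) (-t) x = planeRefl e t x := by
  simp only [planeRefl, height, inner_neg_left]
  module

lemma height_neg_neg (x : V) : height (-e) (-t) x = -height e t x := by
  simp only [height, inner_neg_left]
  ring

lemma sq_norm_sub_planeRefl (he : ‖e‖ = 1) (x y : V) :
    ‖x - planeRefl e t y‖ ^ 2 = ‖x - y‖ ^ 2 + 4 * (height e t x * height e t y) := by
  have h1 : x - planeRefl e t y = (x - y) + (2 * height e t y) • e := by
    rw [planeRefl]; module
  rw [h1, norm_add_sq_real, norm_smul, he, inner_smul_right, real_inner_comm]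
  simp only [height, inner_sub_right, Real.norm_eq_abs, mul_one, sq_abs]
  ring

lemma norm_planeRefl_sub_planeRefl (he : ‖e‖ = 1) (x y : V) :
    ‖planeRefl e t x - planeRefl e t y‖ = ‖x - y‖ := by
  have h := sq_norm_sub_planeRefl (t := t) he (planeRefl e t x) y
  have h' := sq_norm_sub_planeRefl (t := t) he y x
  rw [height_planeRefl he, norm_sub_rev _ y, h', norm_sub_rev y x] at h
  exact (sq_eq_sq₀ (norm_nonneg _) (norm_nonneg _)).1 (by linarith)

lemma norm_planeRefl_sub (he : ‖e‖ = 1) (x y : V) :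
    ‖planeRefl e t x - y‖ = ‖x - planeRefl e t y‖ := by
  rw [← norm_planeRefl_sub_planeRefl (t := t) he, planeRefl_planeRefl he]

lemma norm_sub_planeRefl_le (he : ‖e‖ = 1) {x y : V} (h : height e t x * height e t y ≤ 0) :
    ‖x - planeRefl e t y‖ ≤ ‖x - y‖ :=
  (sq_le_sq₀ (norm_nonneg _) (norm_nonneg _)).1
    (by rw [sq_norm_sub_planeRefl he]; linarith)

lemma norm_sub_le_norm_sub_planeRefl (he : ‖e‖ = 1) {x y : V}
    (h : 0 ≤ height e t x * height e t y) : ‖x - y‖ ≤ ‖x - planeRefl e t y‖ :=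
  (sq_le_sq₀ (norm_nonneg _) (norm_nonneg _)).1
    (by rw [sq_norm_sub_planeRefl he]; linarith)

lemma norm_sub_lt_norm_sub_planeRefl (he : ‖e‖ = 1) {x y : V}
    (h : 0 < height e t x * height e t y) : ‖x - y‖ < ‖x - planeRefl e t y‖ :=
  (sq_lt_sq₀ (norm_nonneg _) (norm_nonneg _)).1
    (by rw [sq_norm_sub_planeRefl he]; linarith)

lemma isometry_planeRefl (he : ‖e‖ = 1) : Isometry (planeRefl e t) :=
  Isometry.of_dist_eq fun x y => by simp only [dist_eq_norm, norm_planeRefl_sub_planeRefl he]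

@[fun_prop]
lemma continuous_height : Continuous (height e t) := by
  unfold height; fun_prop

@[fun_prop]
lemma continuous_planeRefl : Continuous (planeRefl e t) := by
  unfold planeRefl; fun_prop

variable [MeasurableSpace V] [BorelSpace V]

@[fun_prop]
lemma measurable_height : Measurable (height e t) := continuous_height.measurable

@[fun_prop]
lemma measurable_planeRefl : Measurable (planeRefl e t) := continuous_planeRefl.measurable

variable [FiniteDimensional ℝ V]

lemma measurePreserving_planeRefl (he : ‖e‖ = 1) :
    MeasurePreserving (planeRefl e t) (volume : Measure V) volume := by
  have h0 : MeasurePreserving (planeRefl e 0) (volume : Measure V) volume := by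
    let R : V →ₗ[ℝ] V :=
      { toFun := planeRefl e 0
        map_add' := fun x y => by simp only [planeRefl, height, inner_add_right]; module
        map_smul' := fun c x => by
          simp only [planeRefl, height, inner_smul_right, RingHom.id_apply]; module }
    let R' : V ≃ₗᵢ[ℝ] V :=
      { LinearEquiv.ofInvolutive R (planeRefl_involutive he) with
        norm_map' := fun x => by
          have h := norm_planeRefl_sub_planeRefl (t := 0) he x 0
          have h1 : planeRefl e 0 0 = 0 := by simp [planeRefl, height]
          rw [h1] at h
          rw [sub_zero, sub_zero] at h
          exact h }
    exact R'.measurePreserving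
  have h1 : planeRefl e t = (fun x => x + (2 * t) • e) ∘ planeRefl e 0 := by
    ext x
    simp only [planeRefl, height, Function.comp]
    module
  rw [h1]
  exact (measurePreserving_add_right volume _).comp h0

lemma measurableEmbedding_planeRefl (he : ‖e‖ = 1) : MeasurableEmbedding (planeRefl e t) :=
  continuous_planeRefl.measurableEmbedding (planeRefl_involutive he).injective

lemma lintegral_comp_planeRefl (he : ‖e‖ = 1) {Ω : Set V} (hΩ : planeRefl e t ⁻¹' Ω = Ω)
    (f : V → ℝ≥0∞) : ∫⁻ x in Ω, f (planeRefl e t x) = ∫⁻ x in Ω, f x := by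
  conv_lhs => rw [← hΩ]
  exact (measurePreserving_planeRefl he).setLIntegral_comp_preimage_emb
    (measurableEmbedding_planeRefl he) f Ω

end Reflection

/-! ### Polarization at a hyperplane -/

section Polarization

variable {V : Type*} [NormedAddCommGroup V] [InnerProductSpace ℝ V] {e : V} {t : ℝ}

/-- The polarization (two-point rearrangement) of `u` at the hyperplane `{y | ⟪e, y⟫ = t}`: of the
two values of `u` at a pair of mirror points, the larger one is put on the side `⟪e, x⟫ ≥ t`. -/
def polarize (e : V) (t : ℝ) (u : V → ℝ) (x : V) : ℝ :=
  if 0 ≤ height e t x then max (u x) (u (planeRefl e t x)) else min (u x) (u (planeRefl e t x))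

lemma polarize_of_nonneg {u : V → ℝ} {x : V} (hx : 0 ≤ height e t x) :
    polarize e t u x = max (u x) (u (planeRefl e t x)) := if_pos hx

lemma polarize_of_nonpos {u : V → ℝ} {x : V} (hx : height e t x ≤ 0) :
    polarize e t u x = min (u x) (u (planeRefl e t x)) := by
  rcases hx.lt_or_eq with h | h
  · exact if_neg (not_le.2 h)
  · rw [polarize_of_nonneg h.ge, planeRefl_of_height_eq_zero h, max_self, min_self]

lemma polarize_planeRefl_of_nonneg (he : ‖e‖ = 1) {u : V → ℝ} {x : V} (hx : 0 ≤ height e t x) :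
    polarize e t u (planeRefl e t x) = min (u x) (u (planeRefl e t x)) := by
  rw [polarize_of_nonpos (by rw [height_planeRefl he]; linarith), planeRefl_planeRefl he, min_comm]

lemma polarize_planeRefl_of_nonpos (he : ‖e‖ = 1) {u : V → ℝ} {x : V} (hx : height e t x ≤ 0) :
    polarize e t u (planeRefl e t x) = max (u x) (u (planeRefl e t x)) := by
  rw [polarize_of_nonneg (by rw [height_planeRefl he]; linarith), planeRefl_planeRefl he, max_comm]

lemma abs_polarize_sub_le (he : ‖e‖ = 1) {u : V → ℝ} {L : ℝ} (hL : 0 ≤ L)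
    (hu : ∀ x y, |u x - u y| ≤ L * ‖x - y‖) (x y : V) :
    |polarize e t u x - polarize e t u y| ≤ L * ‖x - y‖ := by
  have h1 := abs_le.1 (hu x y)
  have h2 := abs_le.1 (hu (planeRefl e t x) (planeRefl e t y))
  have h3 := abs_le.1 (hu x (planeRefl e t y))
  have h4 := abs_le.1 (hu (planeRefl e t x) y)
  rw [norm_planeRefl_sub_planeRefl he] at h2
  rw [norm_planeRefl_sub he] at h4
  have key : height e t x * height e t y ≤ 0 →
      L * ‖x - planeRefl e t y‖ ≤ L * ‖x - y‖ :=
    fun h => mul_le_mul_of_nonneg_left (norm_sub_planeRefl_le he h) hL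
  rcases le_total 0 (height e t x) with hx | hx <;> rcases le_total 0 (height e t y) with hy | hy
  · rw [polarize_of_nonneg hx, polarize_of_nonneg hy]
    grind
  · have := key (mul_nonpos_of_nonneg_of_nonpos hx hy)
    rw [polarize_of_nonneg hx, polarize_of_nonpos hy]
    grind
  · have := key (mul_nonpos_of_nonpos_of_nonneg hx hy)
    rw [polarize_of_nonpos hx, polarize_of_nonneg hy]
    grind
  · rw [polarize_of_nonpos hx, polarize_of_nonpos hy]
    grind

/-- The amount by which polarization at `{y | ⟪e, y⟫ = t}` decreases the sum of the energy
densities of exponent `q` at the four pairs formed by `x`, `y` and their mirror points, for `x`, `y`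
on the positive side; it is `0` for other `x`, `y`. -/
def gap (q : ℝ) (e : V) (t : ℝ) (u : V → ℝ) (x y : V) : ℝ :=
  if 0 < height e t x ∧ 0 < height e t y then
    2 * (1 / ‖x - y‖ ^ q - 1 / ‖x - planeRefl e t y‖ ^ q) *
      max 0 (-((u x - u (planeRefl e t x)) * (u y - u (planeRefl e t y))))
  else 0

/-- The density of the energy with kernel `|x - y| ^ (-q)`. -/
def density (q : ℝ) (u : V → ℝ) (x y : V) : ℝ := (u x - u y) ^ 2 / ‖x - y‖ ^ q

lemma density_nonneg {E : Type*} [NormedAddCommGroup E] (q : ℝ) (u : E → ℝ) (x y : E) :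
    0 ≤ density q u x y := by
  unfold density; positivity

/-- The sum of the densities over the four pairs formed by `x`, `y` and their mirror points. -/
def foldedDensity (q : ℝ) (e : V) (t : ℝ) (u : V → ℝ) (x y : V) : ℝ :=
  density q u x y + density q u (planeRefl e t x) (planeRefl e t y) +
    density q u x (planeRefl e t y) + density q u (planeRefl e t x) y

lemma foldedDensity_nonneg (q : ℝ) (e : V) (t : ℝ) (u : V → ℝ) (x y : V) :
    0 ≤ foldedDensity q e t u x y := by
  have h := density_nonneg q u
  exact add_nonneg (add_nonneg (add_nonneg (h _ _) (h _ _)) (h _ _)) (h _ _)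

lemma foldedDensity_planeRefl_left (he : ‖e‖ = 1) (q : ℝ) (u : V → ℝ) (x y : V) :
    foldedDensity q e t u (planeRefl e t x) y = foldedDensity q e t u x y := by
  simp only [foldedDensity, planeRefl_planeRefl he]; ring

lemma foldedDensity_planeRefl_right (he : ‖e‖ = 1) (q : ℝ) (u : V → ℝ) (x y : V) :
    foldedDensity q e t u x (planeRefl e t y) = foldedDensity q e t u x y := by
  simp only [foldedDensity, planeRefl_planeRefl he]; ring

lemma foldedDensity_eq (he : ‖e‖ = 1) (q : ℝ) (u : V → ℝ) (x y : V) :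
    foldedDensity q e t u x y =
      ((u x - u y) ^ 2 + (u (planeRefl e t x) - u (planeRefl e t y)) ^ 2) * (1 / ‖x - y‖ ^ q) +
      ((u x - u (planeRefl e t y)) ^ 2 + (u (planeRefl e t x) - u y) ^ 2) *
        (1 / ‖x - planeRefl e t y‖ ^ q) := by
  simp only [foldedDensity, density, norm_planeRefl_sub_planeRefl he, norm_planeRefl_sub he]
  ring

/-- The two-point identity behind polarization: `K` and `K'` stand for the kernel at two points on the
same side and on opposite sides. -/
lemma two_point_identity (a a' b b' K K' : ℝ) :
    ((max a a' - max b b') ^ 2 + (min a a' - min b b') ^ 2) * K +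
      ((max a a' - min b b') ^ 2 + (min a a' - max b b') ^ 2) * K' +
      2 * (K - K') * max 0 (-((a - a') * (b - b'))) =
    ((a - b) ^ 2 + (a' - b') ^ 2) * K + ((a - b') ^ 2 + (a' - b) ^ 2) * K' := by
  rcases le_total a a' with ha | ha <;> rcases le_total b b' with hb | hb
  · rw [max_eq_right ha, max_eq_right hb, min_eq_left ha, min_eq_left hb, max_eq_left (by nlinarith)]
    ring
  · rw [max_eq_right ha, max_eq_left hb, min_eq_left ha, min_eq_right hb,
      max_eq_right (by nlinarith)]
    ring
  · rw [max_eq_left ha, max_eq_right hb, min_eq_right ha, min_eq_left hb,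
      max_eq_right (by nlinarith)]
    ring
  · rw [max_eq_left ha, max_eq_left hb, min_eq_right ha, min_eq_right hb,
      max_eq_left (by nlinarith)]
    ring

lemma gap_factors_nonneg (he : ‖e‖ = 1) {q : ℝ} (hq : 0 ≤ q) (u : V → ℝ) {x y : V}
    (hx : 0 ≤ height e t x) (hy : 0 ≤ height e t y) :
    0 ≤ 2 * (1 / ‖x - y‖ ^ q - 1 / ‖x - planeRefl e t y‖ ^ q) *
      max 0 (-((u x - u (planeRefl e t x)) * (u y - u (planeRefl e t y)))) := by
  by_cases hxy : x = y
  · -- the kernel has the junk value `0` (or `1`) on the diagonal, where the other factor vanishes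
    subst hxy
    rw [max_eq_left (by nlinarith [mul_self_nonneg (u x - u (planeRefl e t x))])]
    simp
  · have h0 : 0 < ‖x - y‖ := norm_pos_iff.2 (sub_ne_zero.2 hxy)
    have h1 := norm_sub_le_norm_sub_planeRefl he (mul_nonneg hx hy)
    have h2 : 1 / ‖x - planeRefl e t y‖ ^ q ≤ 1 / ‖x - y‖ ^ q :=
      one_div_le_one_div_of_le (Real.rpow_pos_of_pos h0 q) (Real.rpow_le_rpow h0.le h1 hq)
    have := le_max_left 0 (-((u x - u (planeRefl e t x)) * (u y - u (planeRefl e t y))))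
    exact mul_nonneg (by linarith) this

lemma gap_nonneg (he : ‖e‖ = 1) {q : ℝ} (hq : 0 ≤ q) (u : V → ℝ) (x y : V) :
    0 ≤ gap q e t u x y := by
  unfold gap
  split_ifs with h
  · exact gap_factors_nonneg he hq u h.1.le h.2.le
  · exact le_rfl

lemma foldedDensity_polarize_add (he : ‖e‖ = 1) (q : ℝ) (u : V → ℝ) {x y : V}
    (hx : 0 ≤ height e t x) (hy : 0 ≤ height e t y) :
    foldedDensity q e t (polarize e t u) x y +
      2 * (1 / ‖x - y‖ ^ q - 1 / ‖x - planeRefl e t y‖ ^ q) *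
        max 0 (-((u x - u (planeRefl e t x)) * (u y - u (planeRefl e t y)))) =
    foldedDensity q e t u x y := by
  rw [foldedDensity_eq he, foldedDensity_eq he, polarize_of_nonneg hx, polarize_of_nonneg hy,
    polarize_planeRefl_of_nonneg he hx, polarize_planeRefl_of_nonneg he hy]
  exact two_point_identity _ _ _ _ _ _

lemma foldedDensity_polarize_add_gap_le (he : ‖e‖ = 1) {q : ℝ} (hq : 0 ≤ q) (u : V → ℝ)
    (x y : V) :
    foldedDensity q e t (polarize e t u) x y + gap q e t u x y ≤ foldedDensity q e t u x y := by
  have key : ∀ x y : V, 0 ≤ height e t x → 0 ≤ height e t y →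
      foldedDensity q e t (polarize e t u) x y ≤ foldedDensity q e t u x y := by
    intro x y hx hy
    rw [← foldedDensity_polarize_add he q u hx hy]
    exact le_add_of_nonneg_right (gap_factors_nonneg he hq u hx hy)
  by_cases h : 0 < height e t x ∧ 0 < height e t y
  · rw [gap, if_pos h, foldedDensity_polarize_add he q u h.1.le h.2.le]
  · rw [gap, if_neg h, add_zero]
    -- the folded density does not change when a point is replaced by its mirror point
    rcases le_total 0 (height e t x) with hx | hx <;> rcases le_total 0 (height e t y) with hy | hy
    · exact key x y hx hy
    · have := key x (planeRefl e t y) hx (by rw [height_planeRefl he]; linarith)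
      rwa [foldedDensity_planeRefl_right he, foldedDensity_planeRefl_right he] at this
    · have := key (planeRefl e t x) y (by rw [height_planeRefl he]; linarith) hy
      rwa [foldedDensity_planeRefl_left he, foldedDensity_planeRefl_left he] at this
    · have := key (planeRefl e t x) (planeRefl e t y) (by rw [height_planeRefl he]; linarith)
        (by rw [height_planeRefl he]; linarith)
      rwa [foldedDensity_planeRefl_right he, foldedDensity_planeRefl_right he,
        foldedDensity_planeRefl_left he, foldedDensity_planeRefl_left he] at this

end Polarization

/-! ### Energy and mass of a polarization -/

section PolarizedIntegrals

variable {n : ℕ} {e : EuclideanSpace ℝ (Fin n)} {t : ℝ} {Ω : Set (EuclideanSpace ℝ (Fin n))}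

lemma measurable_polarize {u : EuclideanSpace ℝ (Fin n) → ℝ} (hu : Measurable u) :
    Measurable (polarize e t u) := by
  unfold polarize
  exact Measurable.ite (measurableSet_le measurable_const measurable_height)
    (hu.max (hu.comp measurable_planeRefl)) (hu.min (hu.comp measurable_planeRefl))

@[fun_prop]
lemma measurable_density (q : ℝ) {u : EuclideanSpace ℝ (Fin n) → ℝ} (hu : Measurable u) :
    Measurable fun z : EuclideanSpace ℝ (Fin n) × EuclideanSpace ℝ (Fin n) =>
      density q u z.1 z.2 := by
  unfold density
  fun_prop

lemma measurable_gap (q : ℝ) {u : EuclideanSpace ℝ (Fin n) → ℝ} (hu : Measurable u) :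
    Measurable fun z : EuclideanSpace ℝ (Fin n) × EuclideanSpace ℝ (Fin n) =>
      gap q e t u z.1 z.2 := by
  unfold gap
  refine Measurable.ite ?_ (by fun_prop) measurable_const
  exact (measurableSet_lt measurable_const (measurable_height.comp measurable_fst)).inter
    (measurableSet_lt measurable_const (measurable_height.comp measurable_snd))

lemma energy_eq (σ : ℝ) (u : EuclideanSpace ℝ (Fin n) → ℝ) :
    energy σ Ω u = ∫⁻ x in Ω, ∫⁻ y in Ω, ENNReal.ofReal (density (n + 2 * σ) u x y) := rfl

lemma four_mul_lintegral_lintegral (he : ‖e‖ = 1) (hΩ : planeRefl e t ⁻¹' Ω = Ω)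
    {F : EuclideanSpace ℝ (Fin n) → EuclideanSpace ℝ (Fin n) → ℝ≥0∞}
    (hF : Measurable fun z : EuclideanSpace ℝ (Fin n) × EuclideanSpace ℝ (Fin n) => F z.1 z.2) :
    4 * ∫⁻ x in Ω, ∫⁻ y in Ω, F x y =
      ∫⁻ x in Ω, ∫⁻ y in Ω, (F x y + F (planeRefl e t x) (planeRefl e t y) +
        F x (planeRefl e t y) + F (planeRefl e t x) y) := by
  have hm : ∀ x, Measurable (F x) := fun x => hF.comp measurable_prodMk_left
  have hs : Measurable (planeRefl e t) := measurable_planeRefl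
  have hi : Measurable fun x => ∫⁻ y in Ω, F x y := hF.lintegral_prod_right
  have h1 : ∀ x, ∫⁻ y in Ω, (F x y + F (planeRefl e t x) (planeRefl e t y) +
        F x (planeRefl e t y) + F (planeRefl e t x) y) =
      (∫⁻ y in Ω, F x y) + (∫⁻ y in Ω, F (planeRefl e t x) y) +
        (∫⁻ y in Ω, F x y) + ∫⁻ y in Ω, F (planeRefl e t x) y := by
    intro x
    have h2 : Measurable fun y => F x (planeRefl e t y) := (hm _).comp hs
    rw [lintegral_add_right _ (hm _), lintegral_add_right _ h2, lintegral_add_left (hm _),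
      lintegral_comp_planeRefl he hΩ (F (planeRefl e t x)),
      lintegral_comp_planeRefl he hΩ (F x)]
  simp only [h1]
  have h2 : Measurable fun x => ∫⁻ y in Ω, F (planeRefl e t x) y := hi.comp hs
  rw [lintegral_add_right _ h2, lintegral_add_right _ hi, lintegral_add_left hi,
    lintegral_comp_planeRefl he hΩ (fun x => ∫⁻ y in Ω, F x y)]
  ring

lemma four_mul_energy (he : ‖e‖ = 1) (hΩ : planeRefl e t ⁻¹' Ω = Ω) (σ : ℝ)
    {u : EuclideanSpace ℝ (Fin n) → ℝ} (hu : Measurable u) :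
    4 * energy σ Ω u =
      ∫⁻ x in Ω, ∫⁻ y in Ω, ENNReal.ofReal (foldedDensity (n + 2 * σ) e t u x y) := by
  rw [energy_eq, four_mul_lintegral_lintegral he hΩ
    (F := fun x y => ENNReal.ofReal (density (n + 2 * σ) u x y))
    (measurable_density (n + 2 * σ) hu).ennreal_ofReal]
  have h := density_nonneg (E := EuclideanSpace ℝ (Fin n)) ((n : ℝ) + 2 * σ) u
  simp only [foldedDensity]
  refine lintegral_congr fun x => lintegral_congr fun y => ?_
  rw [ENNReal.ofReal_add (add_nonneg (add_nonneg (h _ _) (h _ _)) (h _ _)) (h _ _),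
    ENNReal.ofReal_add (add_nonneg (h _ _) (h _ _)) (h _ _),
    ENNReal.ofReal_add (h _ _) (h _ _)]

lemma lintegral_lintegral_add_le
    {F G H : EuclideanSpace ℝ (Fin n) → EuclideanSpace ℝ (Fin n) → ℝ≥0∞}
    (hG : Measurable fun z : EuclideanSpace ℝ (Fin n) × EuclideanSpace ℝ (Fin n) => G z.1 z.2)
    (h : ∀ x y, F x y + G x y ≤ H x y) :
    (∫⁻ x in Ω, ∫⁻ y in Ω, F x y) + ∫⁻ x in Ω, ∫⁻ y in Ω, G x y ≤
      ∫⁻ x in Ω, ∫⁻ y in Ω, H x y := by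
  have hG1 : Measurable fun x => ∫⁻ y in Ω, G x y := hG.lintegral_prod_right
  rw [← lintegral_add_right _ hG1]
  refine lintegral_mono fun x => ?_
  have hGx : Measurable (G x) := hG.of_uncurry_left
  beta_reduce
  rw [← lintegral_add_right _ hGx]
  exact lintegral_mono fun y => h x y

/-- Polarization at a hyperplane whose reflection preserves `Ω` decreases the energy, and by a
definite amount. -/
lemma four_mul_energy_polarize_add_le (he : ‖e‖ = 1) (hΩ : planeRefl e t ⁻¹' Ω = Ω) {σ : ℝ}
    (hσ : 0 ≤ σ) {u : EuclideanSpace ℝ (Fin n) → ℝ} (hu : Measurable u) :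
    4 * energy σ Ω (polarize e t u) +
        ∫⁻ x in Ω, ∫⁻ y in Ω, ENNReal.ofReal (gap (n + 2 * σ) e t u x y) ≤
      4 * energy σ Ω u := by
  have hq : (0 : ℝ) ≤ n + 2 * σ := by positivity
  obtain ⟨q, hq'⟩ : ∃ q : ℝ, q = n + 2 * σ := ⟨_, rfl⟩
  rw [four_mul_energy he hΩ σ hu, four_mul_energy he hΩ σ (measurable_polarize hu), ← hq']
  rw [← hq'] at hq
  have hg : Measurable fun z : EuclideanSpace ℝ (Fin n) × EuclideanSpace ℝ (Fin n) =>
    ENNReal.ofReal (gap q e t u z.1 z.2) := (measurable_gap q hu).ennreal_ofReal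
  have key : ∀ x y : EuclideanSpace ℝ (Fin n),
      ENNReal.ofReal (foldedDensity q e t (polarize e t u) x y) +
      ENNReal.ofReal (gap q e t u x y) ≤ ENNReal.ofReal (foldedDensity q e t u x y) := by
    intro x y
    rw [← ENNReal.ofReal_add (foldedDensity_nonneg _ _ _ _ _ _) (gap_nonneg he hq u x y)]
    exact ENNReal.ofReal_le_ofReal (foldedDensity_polarize_add_gap_le he hq u x y)
  exact lintegral_lintegral_add_le hg key

lemma critMass_polarize (he : ‖e‖ = 1) (hΩ : planeRefl e t ⁻¹' Ω = Ω) (σ : ℝ)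
    {u : EuclideanSpace ℝ (Fin n) → ℝ} (hu : Measurable u) :
    critMass σ Ω (polarize e t u) = critMass σ Ω u := by
  have key : ∀ v : EuclideanSpace ℝ (Fin n) → ℝ, Measurable v → 2 * critMass σ Ω v =
      ∫⁻ x in Ω, (ENNReal.ofReal (|v x| ^ critExp n σ) +
        ENNReal.ofReal (|v (planeRefl e t x)| ^ critExp n σ)) := by
    intro v hv
    rw [lintegral_add_left (by fun_prop), lintegral_comp_planeRefl he hΩ
      (fun x => ENNReal.ofReal (|v x| ^ critExp n σ)), two_mul]
    rfl
  have h2 : 2 * critMass σ Ω (polarize e t u) = 2 * critMass σ Ω u := by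
    rw [key _ hu, key _ (measurable_polarize hu)]
    refine lintegral_congr fun x => ?_
    rcases le_total 0 (height e t x) with hx | hx
    · rw [polarize_of_nonneg hx, polarize_planeRefl_of_nonneg he hx]
      rcases le_total (u x) (u (planeRefl e t x)) with h | h
      · rw [max_eq_right h, min_eq_left h, add_comm]
      · rw [max_eq_left h, min_eq_right h]
    · rw [polarize_of_nonpos hx, polarize_planeRefl_of_nonpos he hx]
      rcases le_total (u x) (u (planeRefl e t x)) with h | h
      · rw [max_eq_right h, min_eq_left h]
      · rw [max_eq_left h, min_eq_right h, add_comm]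
  exact (ENNReal.mul_right_inj (by norm_num) (by norm_num)).1 h2

end PolarizedIntegrals

/-! ### Energy of compactly supported Lipschitz functions -/

section LipschitzEnergy

variable {n : ℕ} {σ : ℝ} {Ω : Set (EuclideanSpace ℝ (Fin n))}

/-- A radial majorant of the energy density of a bounded Lipschitz function. -/
def radialBound (n : ℕ) (σ A B r : ℝ) : ℝ := min (A * r ^ 2) B / r ^ ((n : ℝ) + 2 * σ)

lemma radialBound_nonneg {A B r : ℝ} (hA : 0 ≤ A) (hB : 0 ≤ B) (hr : 0 ≤ r) :
    0 ≤ radialBound n σ A B r :=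
  div_nonneg (le_min (by positivity) hB) (Real.rpow_nonneg hr _)

lemma measurable_radialBound (A B : ℝ) : Measurable (radialBound n σ A B) := by
  unfold radialBound; fun_prop

lemma integrable_radialBound (hn : 1 ≤ n) (hσ : 0 < σ) (hσ' : σ < 1) {A B : ℝ} (hA : 0 ≤ A)
    (hB : 0 ≤ B) :
    Integrable (fun z : EuclideanSpace ℝ (Fin n) => radialBound n σ A B ‖z‖) := by
  have : Nonempty (Fin n) := ⟨⟨0, hn⟩⟩
  rw [integrable_fun_norm_addHaar volume (f := radialBound n σ A B), finrank_euclideanSpace_fin,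
    ← Set.Ioc_union_Ioi_eq_Ioi zero_le_one]
  have hm : Measurable fun y : ℝ => y ^ (n - 1) • radialBound n σ A B y :=
    (measurable_id.pow_const _).smul (measurable_radialBound A B)
  have hpow : ∀ y : ℝ, 0 < y → y ^ (n - 1) = y ^ ((n : ℝ) - 1) := by
    intro y _
    rw [← Real.rpow_natCast, Nat.cast_sub hn, Nat.cast_one]
  have hn0 : ∀ y : ℝ, 0 < y → 0 ≤ y ^ (n - 1) • radialBound n σ A B y := fun y hy =>
    mul_nonneg (by positivity) (radialBound_nonneg hA hB hy.le)
  refine IntegrableOn.union ?_ ?_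
  · have h1 : IntegrableOn (fun y : ℝ => A * y ^ (1 - 2 * σ)) (Set.Ioc 0 1) :=
      ((intervalIntegrable_iff_integrableOn_Ioc_of_le zero_le_one).1
        (intervalIntegral.intervalIntegrable_rpow' (by linarith))).const_mul A
    refine h1.mono' hm.aestronglyMeasurable ?_
    filter_upwards [ae_restrict_mem measurableSet_Ioc] with y hy
    rw [Real.norm_of_nonneg (hn0 y hy.1), hpow y hy.1, smul_eq_mul, radialBound, ← mul_div_assoc,
      div_le_iff₀ (Real.rpow_pos_of_pos hy.1 _), mul_assoc, ← Real.rpow_add hy.1]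
    calc y ^ ((n : ℝ) - 1) * min (A * y ^ 2) B ≤ y ^ ((n : ℝ) - 1) * (A * y ^ (2 : ℝ)) := by
          rw [Real.rpow_two]
          exact mul_le_mul_of_nonneg_left (min_le_left _ _) (Real.rpow_nonneg hy.1.le _)
      _ = A * y ^ (1 - 2 * σ + (n + 2 * σ)) := by
          rw [mul_left_comm, ← Real.rpow_add hy.1]; ring_nf
  · have h1 : IntegrableOn (fun y : ℝ => B * y ^ (-1 - 2 * σ)) (Set.Ioi 1) :=
      (integrableOn_Ioi_rpow_of_lt (by linarith) one_pos).const_mul B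
    refine h1.mono' hm.aestronglyMeasurable ?_
    filter_upwards [ae_restrict_mem measurableSet_Ioi] with y hy
    have hy0 : (0 : ℝ) < y := one_pos.trans hy
    rw [Real.norm_of_nonneg (hn0 y hy0), hpow y hy0, smul_eq_mul, radialBound, ← mul_div_assoc,
      div_le_iff₀ (Real.rpow_pos_of_pos hy0 _), mul_assoc, ← Real.rpow_add hy0]
    calc y ^ ((n : ℝ) - 1) * min (A * y ^ 2) B ≤ y ^ ((n : ℝ) - 1) * B :=
          mul_le_mul_of_nonneg_left (min_le_right _ _) (Real.rpow_nonneg hy0.le _)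
      _ = B * y ^ (-1 - 2 * σ + (n + 2 * σ)) := by
          rw [mul_comm]; ring_nf

/-- The majorant, on pairs of points, of the energy density of a bounded Lipschitz function that
vanishes off `C`. -/
def pairBound (σ A B : ℝ) (C : Set (EuclideanSpace ℝ (Fin n)))
    (z : EuclideanSpace ℝ (Fin n) × EuclideanSpace ℝ (Fin n)) : ℝ≥0∞ :=
  (C.indicator 1 z.1 + C.indicator 1 z.2) * ENNReal.ofReal (radialBound n σ A B ‖z.1 - z.2‖)

lemma lintegral_pairBound_ne_top (hn : 1 ≤ n) (hσ : 0 < σ) (hσ' : σ < 1) {A B : ℝ} (hA : 0 ≤ A)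
    (hB : 0 ≤ B) {C : Set (EuclideanSpace ℝ (Fin n))} (hC : IsCompact C) :
    ∫⁻ z, pairBound σ A B C z ∂((volume.restrict Ω).prod (volume.restrict Ω)) ≠ ⊤ := by
  set g : EuclideanSpace ℝ (Fin n) → ℝ≥0∞ := fun z => ENNReal.ofReal (radialBound n σ A B ‖z‖)
    with hg
  have hgm : Measurable g := ((measurable_radialBound A B).comp measurable_norm).ennreal_ofReal
  have hgi : ∫⁻ z, g z ≠ ⊤ := by
    have h := (integrable_radialBound hn hσ hσ' hA hB).hasFiniteIntegral
    rw [hasFiniteIntegral_iff_ofReal (Eventually.of_forall fun z =>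
      radialBound_nonneg hA hB (norm_nonneg z))] at h
    exact h.ne
  have hCm : Measurable (C.indicator (1 : EuclideanSpace ℝ (Fin n) → ℝ≥0∞)) :=
    measurable_one.indicator hC.measurableSet
  have hCi : ∫⁻ x, C.indicator (1 : EuclideanSpace ℝ (Fin n) → ℝ≥0∞) x ≠ ⊤ := by
    rw [lintegral_indicator_one hC.measurableSet]
    exact hC.measure_lt_top.ne
  have h1 : ∀ x, ∫⁻ y, C.indicator 1 x * g (x - y) = C.indicator 1 x * ∫⁻ z, g z := by
    intro x
    rw [lintegral_const_mul _ (show Measurable fun y => g (x - y) from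
        hgm.comp (measurable_const.sub measurable_id)),
      lintegral_sub_left_eq_self g x]
  have h2 : ∀ y, ∫⁻ x, C.indicator 1 y * g (x - y) = C.indicator 1 y * ∫⁻ z, g z := by
    intro y
    rw [lintegral_const_mul _ (show Measurable fun x => g (x - y) from
        hgm.comp (measurable_id.sub measurable_const)),
      lintegral_sub_right_eq_self g y]
  have hm1 : Measurable fun z : EuclideanSpace ℝ (Fin n) × EuclideanSpace ℝ (Fin n) =>
      C.indicator (1 : EuclideanSpace ℝ (Fin n) → ℝ≥0∞) z.1 * g (z.1 - z.2) :=
    (hCm.comp measurable_fst).mul (hgm.comp (measurable_fst.sub measurable_snd))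
  have hm2 : Measurable fun z : EuclideanSpace ℝ (Fin n) × EuclideanSpace ℝ (Fin n) =>
      C.indicator (1 : EuclideanSpace ℝ (Fin n) → ℝ≥0∞) z.2 * g (z.1 - z.2) :=
    (hCm.comp measurable_snd).mul (hgm.comp (measurable_fst.sub measurable_snd))
  have hle : ∫⁻ z, pairBound σ A B C z ∂((volume.restrict Ω).prod (volume.restrict Ω)) ≤
      ∫⁻ z, pairBound σ A B C z ∂(volume.prod volume) := by
    rw [Measure.prod_restrict]
    exact setLIntegral_le_lintegral _ _
  refine ne_top_of_le_ne_top ?_ hle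
  have : ∫⁻ z, pairBound σ A B C z ∂(volume.prod volume) =
      (∫⁻ x, C.indicator 1 x * ∫⁻ z, g z) + ∫⁻ y, C.indicator 1 y * ∫⁻ z, g z := by
    simp only [pairBound, add_mul]
    rw [lintegral_add_left hm1, lintegral_prod _ hm1.aemeasurable,
      lintegral_prod_symm _ hm2.aemeasurable]
    simp only [h1, h2]
  rw [this, lintegral_mul_const _ hCm]
  exact ENNReal.add_ne_top.2 ⟨ENNReal.mul_ne_top hCi hgi, ENNReal.mul_ne_top hCi hgi⟩

lemma density_le_pairBound {w : EuclideanSpace ℝ (Fin n) → ℝ} {L M : ℝ}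
    (hL : ∀ x y, |w x - w y| ≤ L * ‖x - y‖) (hM : ∀ x, |w x| ≤ M)
    {C : Set (EuclideanSpace ℝ (Fin n))} (hC : ∀ x ∉ C, w x = 0)
    (z : EuclideanSpace ℝ (Fin n) × EuclideanSpace ℝ (Fin n)) :
    ENNReal.ofReal (density (n + 2 * σ) w z.1 z.2) ≤ pairBound σ (L ^ 2) ((2 * M) ^ 2) C z := by
  obtain ⟨x, y⟩ := z
  simp only [pairBound]
  by_cases h : x ∈ C ∨ y ∈ C
  · have h1 : (1 : ℝ≥0∞) ≤ C.indicator 1 x + C.indicator 1 y := by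
      rcases h with h | h <;> simp [h]
    have h2 : density (n + 2 * σ) w x y ≤ radialBound n σ (L ^ 2) ((2 * M) ^ 2) ‖x - y‖ := by
      refine div_le_div_of_nonneg_right (le_min ?_ ?_) (Real.rpow_nonneg (norm_nonneg _) _)
      · rw [← mul_pow]
        exact sq_le_sq' (by linarith [(abs_le.1 (hL x y)).1]) (abs_le.1 (hL x y)).2
      · have hx := abs_le.1 (hM x)
        have hy := abs_le.1 (hM y)
        exact sq_le_sq' (by linarith) (by linarith)
    calc _ ≤ 1 * ENNReal.ofReal (radialBound n σ (L ^ 2) ((2 * M) ^ 2) ‖x - y‖) := by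
          rw [one_mul]; exact ENNReal.ofReal_le_ofReal h2
      _ ≤ _ := by gcongr
  · push Not at h
    simp [density, hC x h.1, hC y h.2]

lemma energy_eq_lintegral_prod {w : EuclideanSpace ℝ (Fin n) → ℝ} (hw : Measurable w) :
    energy σ Ω w = ∫⁻ z, ENNReal.ofReal (density (n + 2 * σ) w z.1 z.2)
      ∂((volume.restrict Ω).prod (volume.restrict Ω)) := by
  rw [lintegral_prod _ (measurable_density _ hw).ennreal_ofReal.aemeasurable, energy_eq]

lemma energy_ne_top (hn : 1 ≤ n) (hσ : 0 < σ) (hσ' : σ < 1) {w : EuclideanSpace ℝ (Fin n) → ℝ}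
    (hw : Continuous w) {L M : ℝ} (hL : ∀ x y, |w x - w y| ≤ L * ‖x - y‖) (hM : ∀ x, |w x| ≤ M)
    {C : Set (EuclideanSpace ℝ (Fin n))} (hCc : IsCompact C) (hC : ∀ x ∉ C, w x = 0) :
    energy σ Ω w ≠ ⊤ := by
  rw [energy_eq_lintegral_prod hw.measurable]
  exact ne_top_of_le_ne_top
    (lintegral_pairBound_ne_top hn hσ hσ' (sq_nonneg L) (sq_nonneg (2 * M)) hCc)
    (lintegral_mono (density_le_pairBound hL hM hC))

lemma critExp_pos (hn : 2 ≤ n) (hσ' : σ < 1) : 0 < critExp n σ := by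
  have : (2 : ℝ) ≤ n := by exact_mod_cast hn
  exact div_pos (by linarith) (by linarith)

lemma ofReal_abs_rpow_le_indicator (hp : 0 < critExp n σ) {w : EuclideanSpace ℝ (Fin n) → ℝ}
    {M : ℝ} (hM : ∀ x, |w x| ≤ M) {C : Set (EuclideanSpace ℝ (Fin n))} (hC : ∀ x ∉ C, w x = 0)
    (x : EuclideanSpace ℝ (Fin n)) :
    ENNReal.ofReal (|w x| ^ critExp n σ) ≤
      C.indicator (fun _ => ENNReal.ofReal (M ^ critExp n σ)) x := by
  by_cases h : x ∈ C
  · rw [Set.indicator_of_mem h]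
    exact ENNReal.ofReal_le_ofReal (Real.rpow_le_rpow (abs_nonneg _) (hM x) hp.le)
  · simp [hC x h, Real.zero_rpow hp.ne']

lemma lintegral_indicator_const_ne_top {C : Set (EuclideanSpace ℝ (Fin n))} (hCc : IsCompact C)
    (c : ℝ) : ∫⁻ x in Ω, C.indicator (fun _ => ENNReal.ofReal c) x ≠ ⊤ := by
  refine ne_top_of_le_ne_top ?_ (setLIntegral_le_lintegral _ _)
  rw [lintegral_indicator_const hCc.measurableSet]
  exact ENNReal.mul_ne_top ENNReal.ofReal_ne_top hCc.measure_lt_top.ne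

lemma critMass_ne_top (hp : 0 < critExp n σ) {w : EuclideanSpace ℝ (Fin n) → ℝ} {M : ℝ}
    (hM : ∀ x, |w x| ≤ M) {C : Set (EuclideanSpace ℝ (Fin n))} (hCc : IsCompact C)
    (hC : ∀ x ∉ C, w x = 0) : critMass σ Ω w ≠ ⊤ :=
  ne_top_of_le_ne_top (lintegral_indicator_const_ne_top hCc (M ^ critExp n σ))
    (lintegral_mono (ofReal_abs_rpow_le_indicator hp hM hC))

/-- Energy and mass are continuous along pointwise convergent sequences of functions with common
Lipschitz constant, bound, and compact support. -/
lemma tendsto_energy_critMass (hn : 2 ≤ n) (hσ : 0 < σ) (hσ' : σ < 1)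
    {w : EuclideanSpace ℝ (Fin n) → ℝ} {v : ℕ → EuclideanSpace ℝ (Fin n) → ℝ} (hw : Continuous w)
    (hv : ∀ j, Continuous (v j)) {L M : ℝ} (hL : ∀ j x y, |v j x - v j y| ≤ L * ‖x - y‖)
    (hM : ∀ j x, |v j x| ≤ M) {C : Set (EuclideanSpace ℝ (Fin n))} (hCc : IsCompact C)
    (hC : ∀ j, ∀ x ∉ C, v j x = 0) (hlim : ∀ x, Tendsto (fun j => v j x) atTop (𝓝 (w x))) :
    Tendsto (fun j => energy σ Ω (v j)) atTop (𝓝 (energy σ Ω w)) ∧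
      Tendsto (fun j => critMass σ Ω (v j)) atTop (𝓝 (critMass σ Ω w)) := by
  have hp := critExp_pos hn hσ'
  constructor
  · simp only [energy_eq_lintegral_prod hw.measurable,
      fun j => energy_eq_lintegral_prod (σ := σ) (Ω := Ω) (hv j).measurable]
    refine tendsto_lintegral_of_dominated_convergence _
      (fun j => (measurable_density _ (hv j).measurable).ennreal_ofReal)
      (fun j => Eventually.of_forall (density_le_pairBound (hL j) (hM j) (hC j)))
      (lintegral_pairBound_ne_top (by omega) hσ hσ' (sq_nonneg L) (sq_nonneg (2 * M)) hCc)
      (Eventually.of_forall fun z => ?_)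
    exact ENNReal.tendsto_ofReal ((((hlim z.1).sub (hlim z.2)).pow 2).div_const _)
  · refine tendsto_lintegral_of_dominated_convergence _
      (fun j => by have := (hv j).measurable; fun_prop)
      (fun j => Eventually.of_forall (ofReal_abs_rpow_le_indicator hp (hM j) (hC j)))
      (lintegral_indicator_const_ne_top hCc (M ^ critExp n σ)) (Eventually.of_forall fun x => ?_)
    exact ENNReal.tendsto_ofReal ((hlim x).abs.rpow_const (Or.inr hp.le))

end LipschitzEnergy

/-! ### Mollification -/

section Mollification

variable {n : ℕ}

open scoped Convolution

lemma abs_convolution_sub_le (φ : ContDiffBump (0 : EuclideanSpace ℝ (Fin n)))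
    {w : EuclideanSpace ℝ (Fin n) → ℝ} (hw : Continuous w) {L : ℝ}
    (hL : ∀ x y, |w x - w y| ≤ L * ‖x - y‖) (x y : EuclideanSpace ℝ (Fin n)) :
    |(φ.normed volume ⋆[ContinuousLinearMap.lsmul ℝ ℝ, volume] w) x -
      (φ.normed volume ⋆[ContinuousLinearMap.lsmul ℝ ℝ, volume] w) y| ≤ L * ‖x - y‖ := by
  have hi : ∀ x, Integrable fun s => φ.normed volume s * w (x - s) := fun x =>
    (φ.continuous_normed.mul (hw.comp (continuous_const.sub continuous_id))).integrable_of_hasCompactSupport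
      φ.hasCompactSupport_normed.mul_right
  simp only [convolution, ContinuousLinearMap.lsmul_apply, smul_eq_mul]
  rw [← integral_sub (hi x) (hi y), ← Real.norm_eq_abs]
  have hφ : Integrable (fun s => φ.normed volume s * (L * ‖x - y‖)) :=
    φ.integrable_normed.mul_const _
  refine (norm_integral_le_of_norm_le hφ (Eventually.of_forall fun s => ?_)).trans_eq ?_
  · rw [← mul_sub, norm_mul, Real.norm_of_nonneg (φ.nonneg_normed s), Real.norm_eq_abs]
    refine mul_le_mul_of_nonneg_left ?_ (φ.nonneg_normed s)
    simpa using hL (x - s) (y - s)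
  · rw [integral_mul_const, φ.integral_normed, one_mul]

/-- Mollification: a Lipschitz function with compact support in the open set `Ω` is a pointwise
limit of test functions with common Lipschitz constant, bound, and compact support. -/
lemma exists_testFunction_seq {Ω : Set (EuclideanSpace ℝ (Fin n))} (hΩ : IsOpen Ω)
    {w : EuclideanSpace ℝ (Fin n) → ℝ} (hw : Continuous w) (hws : HasCompactSupport w)
    (hwΩ : tsupport w ⊆ Ω) {L : ℝ} (hL0 : 0 ≤ L) (hL : ∀ x y, |w x - w y| ≤ L * ‖x - y‖) :
    ∃ (v : ℕ → EuclideanSpace ℝ (Fin n) → ℝ) (M : ℝ) (C : Set (EuclideanSpace ℝ (Fin n))),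
      (∀ j, IsTestFunction Ω (v j)) ∧ (∀ j x y, |v j x - v j y| ≤ L * ‖x - y‖) ∧
      (∀ j x, |v j x| ≤ M) ∧ IsCompact C ∧ (∀ j, ∀ x ∉ C, v j x = 0) ∧
      ∀ x, Tendsto (fun j => v j x) atTop (𝓝 (w x)) := by
  obtain ⟨δ, hδ, hδΩ⟩ := hws.exists_cthickening_subset_open hΩ hwΩ
  obtain ⟨M, hM⟩ := hws.exists_bound_of_continuous hw
  have hr : ∀ j : ℕ, 0 < δ / ((j : ℝ) + 1) := fun j => by positivity
  have hrδ : ∀ j : ℕ, δ / ((j : ℝ) + 1) ≤ δ := fun j =>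
    div_le_self hδ.le (by linarith [(Nat.cast_nonneg j : (0 : ℝ) ≤ j)])
  let φ : ℕ → ContDiffBump (0 : EuclideanSpace ℝ (Fin n)) := fun j =>
    ⟨δ / ((j : ℝ) + 1) / 2, δ / ((j : ℝ) + 1), half_pos (hr j), half_lt_self (hr j)⟩
  let v : ℕ → EuclideanSpace ℝ (Fin n) → ℝ := fun j =>
    (φ j).normed volume ⋆[ContinuousLinearMap.lsmul ℝ ℝ, volume] w
  have hzero : ∀ j, ∀ x ∉ Metric.cthickening δ (tsupport w), v j x = 0 := by
    intro j x hx
    have h0 : ∀ y ∈ Metric.ball x (φ j).rOut, w y = 0 := by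
      intro y hy
      by_contra h
      refine hx (Metric.mem_cthickening_of_dist_le x y δ _ (subset_tsupport _ h) ?_)
      rw [dist_comm]
      exact (Metric.mem_ball.1 hy).le.trans (hrδ j)
    have hx0 : w x = 0 := h0 x (Metric.mem_ball_self (φ j).rOut_pos)
    have := (φ j).normed_convolution_eq_right (μ := volume) (g := w) (x₀ := x)
      fun y hy => by rw [h0 y hy, hx0]
    rw [← hx0, ← this]
  have hclose : ∀ j x, |v j x - w x| ≤ L * (δ / ((j : ℝ) + 1)) := by
    intro j x
    rw [← Real.dist_eq]
    refine (φ j).dist_normed_convolution_le hw.aestronglyMeasurable fun y hy => ?_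
    rw [Real.dist_eq]
    refine (hL y x).trans (mul_le_mul_of_nonneg_left ?_ hL0)
    rw [← dist_eq_norm]
    exact (Metric.mem_ball.1 hy).le
  have hCc : IsCompact (Metric.cthickening δ (tsupport w)) := hws.cthickening
  refine ⟨v, M + L * δ, Metric.cthickening δ (tsupport w), fun j => ⟨?_, ?_, ?_⟩,
    fun j => abs_convolution_sub_le (φ j) hw hL, fun j x => ?_, hCc, hzero, fun x => ?_⟩
  · exact (φ j).hasCompactSupport_normed.contDiff_convolution_left _ (φ j).contDiff_normed
      hw.locallyIntegrable
  · exact HasCompactSupport.intro hCc (hzero j)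
  · refine (closure_minimal (fun x hx => ?_) Metric.isClosed_cthickening).trans hδΩ
    by_contra h
    exact hx (hzero j x h)
  · have h1 := abs_le.1 (hclose j x)
    have h2 := abs_le.1 (hM x)
    have h3 := mul_le_mul_of_nonneg_left (hrδ j) hL0
    exact abs_le.2 ⟨by linarith, by linarith⟩
  · rw [tendsto_iff_dist_tendsto_zero]
    refine squeeze_zero (fun _ => dist_nonneg)
      (fun j => (Real.dist_eq _ _).trans_le (hclose j x)) ?_
    have : Tendsto (fun j : ℕ => L * δ * (1 / ((j : ℝ) + 1))) atTop (𝓝 (L * δ * 0)) :=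
      tendsto_one_div_add_atTop_nhds_zero_nat.const_mul _
    rw [mul_zero] at this
    convert this using 2 with j
    ring

end Mollification

/-! ### The Sobolev inequality for Lipschitz functions -/

section SharpInequality

variable {n : ℕ} {σ : ℝ} {Ω : Set (EuclideanSpace ℝ (Fin n))}

lemma critMass_const_mul {c : ℝ} (hc : 0 ≤ c) (u : EuclideanSpace ℝ (Fin n) → ℝ) :
    critMass σ Ω (fun x => c * u x) = ENNReal.ofReal (c ^ critExp n σ) * critMass σ Ω u := by
  rw [critMass, critMass, ← lintegral_const_mul' _ _ ENNReal.ofReal_ne_top]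
  refine lintegral_congr fun x => ?_
  rw [abs_mul, abs_of_nonneg hc, Real.mul_rpow hc (abs_nonneg _), ENNReal.ofReal_mul (by positivity)]

lemma energy_const_mul (c : ℝ) (u : EuclideanSpace ℝ (Fin n) → ℝ) :
    energy σ Ω (fun x => c * u x) = ENNReal.ofReal (c ^ 2) * energy σ Ω u := by
  rw [energy, energy, ← lintegral_const_mul' _ _ ENNReal.ofReal_ne_top]
  refine lintegral_congr fun x => ?_
  rw [← lintegral_const_mul' _ _ ENNReal.ofReal_ne_top]
  refine lintegral_congr fun y => ?_
  rw [← ENNReal.ofReal_mul (sq_nonneg c), ← mul_sub, mul_pow, mul_div_assoc]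

/-- The scale-invariant form of the Sobolev inequality, for test functions. -/
lemma IsTestFunction.sharpConst_mul_le (hp : 0 < critExp n σ)
    {φ : EuclideanSpace ℝ (Fin n) → ℝ} (hφ : IsTestFunction Ω φ) (hfin : critMass σ Ω φ ≠ ⊤) :
    sharpConst σ Ω * critMass σ Ω φ ^ (2 / critExp n σ) ≤ energy σ Ω φ := by
  set p := critExp n σ with hpdef
  by_cases h0 : critMass σ Ω φ = 0
  · rw [h0, ENNReal.zero_rpow_of_pos (by positivity), mul_zero]
    exact zero_le
  set m := (critMass σ Ω φ).toReal with hm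
  have hmpos : 0 < m := ENNReal.toReal_pos h0 hfin
  have hcm : critMass σ Ω φ = ENNReal.ofReal m := (ENNReal.ofReal_toReal hfin).symm
  set c := m ^ (-1 / p) with hc
  have hcpos : 0 < c := Real.rpow_pos_of_pos hmpos _
  have hcp : c ^ p * m = 1 := by
    rw [hc, ← Real.rpow_mul hmpos.le, div_mul_cancel₀ _ hp.ne', Real.rpow_neg_one,
      inv_mul_cancel₀ hmpos.ne']
  have hc2 : m ^ (2 / p) * c ^ 2 = 1 := by
    rw [hc, ← Real.rpow_natCast, ← Real.rpow_mul hmpos.le, ← Real.rpow_add hmpos]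
    convert Real.rpow_zero m using 2
    push_cast; ring
  have hmass : critMass σ Ω (fun x => c * φ x) = 1 := by
    rw [critMass_const_mul hcpos.le, hcm, ← ENNReal.ofReal_mul (by positivity), hcp,
      ENNReal.ofReal_one]
  have htest : IsTestFunction Ω (fun x => c * φ x) :=
    ⟨contDiff_const.mul hφ.1, hφ.2.1.mul_left, (tsupport_mul_subset_right).trans hφ.2.2⟩
  have hS : sharpConst σ Ω ≤ ENNReal.ofReal (c ^ 2) * energy σ Ω φ := by
    rw [← energy_const_mul]
    exact iInf_le_of_le _ (iInf_le_of_le htest (iInf_le _ hmass))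
  calc sharpConst σ Ω * critMass σ Ω φ ^ (2 / p)
      ≤ ENNReal.ofReal (c ^ 2) * energy σ Ω φ * critMass σ Ω φ ^ (2 / p) := by gcongr
    _ = ENNReal.ofReal (m ^ (2 / p) * c ^ 2) * energy σ Ω φ := by
        rw [hcm, ENNReal.ofReal_rpow_of_pos hmpos, ENNReal.ofReal_mul (by positivity)]
        ring
    _ = energy σ Ω φ := by rw [hc2, ENNReal.ofReal_one, one_mul]

/-- The Sobolev inequality extends from test functions to compactly supported Lipschitz functions,
such as polarizations of test functions. -/
lemma sharpConst_mul_le_of_lipschitz (hn : 2 ≤ n) (hσ : 0 < σ) (hσ' : σ < 1) (hΩ : IsOpen Ω)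
    {w : EuclideanSpace ℝ (Fin n) → ℝ} (hw : Continuous w) (hws : HasCompactSupport w)
    (hwΩ : tsupport w ⊆ Ω) {L : ℝ} (hL0 : 0 ≤ L) (hL : ∀ x y, |w x - w y| ≤ L * ‖x - y‖)
    (hm : critMass σ Ω w ≠ 0) :
    sharpConst σ Ω * critMass σ Ω w ^ (2 / critExp n σ) ≤ energy σ Ω w := by
  have hp := critExp_pos hn hσ'
  obtain ⟨v, M, C, hv, hvL, hvM, hCc, hC, hlim⟩ := exists_testFunction_seq hΩ hw hws hwΩ hL0 hL
  obtain ⟨hE, hmass⟩ := tendsto_energy_critMass (Ω := Ω) hn hσ hσ' hw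
    (fun j => (hv j).1.continuous) hvL hvM hCc hC hlim
  refine le_of_tendsto_of_tendsto' (ENNReal.Tendsto.const_mul (hmass.ennrpow_const _) (Or.inl ?_))
    hE fun j => (hv j).sharpConst_mul_le hp (critMass_ne_top hp (hvM j) hCc (hC j))
  have : 0 < 2 / critExp n σ := by positivity
  simp [ENNReal.rpow_eq_zero_iff, hm, this, this.le]

end SharpInequality

/-! ### Polarization of minimizers -/

section Minimizer

variable {n : ℕ} {σ : ℝ} {Ω : Set (EuclideanSpace ℝ (Fin n))}

lemma energy_congr_ae {u v : EuclideanSpace ℝ (Fin n) → ℝ} (h : u =ᵐ[volume.restrict Ω] v) :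
    energy σ Ω u = energy σ Ω v := by
  refine lintegral_congr_ae ?_
  filter_upwards [h] with x hx
  refine lintegral_congr_ae ?_
  filter_upwards [h] with y hy
  rw [hx, hy]

lemma critMass_congr_ae {u v : EuclideanSpace ℝ (Fin n) → ℝ} (h : u =ᵐ[volume.restrict Ω] v) :
    critMass σ Ω u = critMass σ Ω v := by
  refine lintegral_congr_ae ?_
  filter_upwards [h] with x hx
  rw [hx]

lemma IsMinimizer.congr_ae {u v : EuclideanSpace ℝ (Fin n) → ℝ} (hu : IsMinimizer σ Ω u)
    (h : u =ᵐ[volume.restrict Ω] v) : IsMinimizer σ Ω v := by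
  obtain ⟨⟨hm, φ, hφ, hE, hM⟩, hmass, henergy⟩ := hu
  have hsub : ∀ k, (fun x => φ k x - u x) =ᵐ[volume.restrict Ω] fun x => φ k x - v x := by
    intro k
    filter_upwards [h] with x hx
    rw [hx]
  refine ⟨⟨hm.congr h, φ, hφ, ?_, ?_⟩, ?_, ?_⟩
  · simpa only [fun k => energy_congr_ae (σ := σ) (hsub k)] using hE
  · simpa only [fun k => critMass_congr_ae (σ := σ) (hsub k)] using hM
  · rw [← critMass_congr_ae h, hmass]
  · rw [← energy_congr_ae h, henergy]

/-- Minkowski's inequality for the energy seminorm. -/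
lemma energy_rpow_half_le {u v : EuclideanSpace ℝ (Fin n) → ℝ} (hu : Measurable u)
    (hv : Measurable v) :
    energy σ Ω v ^ (1 / 2 : ℝ) ≤
      energy σ Ω (fun x => v x - u x) ^ (1 / 2 : ℝ) + energy σ Ω u ^ (1 / 2 : ℝ) := by
  set q : ℝ := n + 2 * σ with hq
  let F : (EuclideanSpace ℝ (Fin n) → ℝ) → EuclideanSpace ℝ (Fin n) × EuclideanSpace ℝ (Fin n) →
    ℝ≥0∞ := fun w z => ENNReal.ofReal (|w z.1 - w z.2| / √(‖z.1 - z.2‖ ^ q))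
  have hF : ∀ w z, F w z ^ (2 : ℝ) = ENNReal.ofReal (density q w z.1 z.2) := by
    intro w z
    rw [ENNReal.rpow_two, ← ENNReal.ofReal_pow (by positivity), div_pow, sq_abs,
      Real.sq_sqrt (by positivity), density]
  have hFm : ∀ w, Measurable w → Measurable (F w) := by
    intro w hw
    simp only [F]
    fun_prop
  have hE : ∀ w : EuclideanSpace ℝ (Fin n) → ℝ, Measurable w → energy σ Ω w =
      ∫⁻ z, F w z ^ (2 : ℝ) ∂((volume.restrict Ω).prod (volume.restrict Ω)) := by
    intro w hw
    simp only [hF]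
    exact energy_eq_lintegral_prod hw
  have hvu : Measurable fun x => v x - u x := hv.sub hu
  rw [hE v hv, hE u hu, hE _ hvu]
  refine le_trans ?_ (ENNReal.lintegral_Lp_add_le (hFm _ hvu).aemeasurable
    (hFm u hu).aemeasurable one_le_two)
  gcongr with z
  simp only [F, Pi.add_apply]
  rw [← ENNReal.ofReal_add (by positivity) (by positivity), ← add_div]
  refine ENNReal.ofReal_le_ofReal (div_le_div_of_nonneg_right ?_ (Real.sqrt_nonneg _))
  calc |v z.1 - v z.2| = |(v z.1 - u z.1 - (v z.2 - u z.2)) + (u z.1 - u z.2)| := by ring_nf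
    _ ≤ _ := abs_add_le _ _

lemma critMass_eq_eLpNorm (hp : 0 < critExp n σ) (u : EuclideanSpace ℝ (Fin n) → ℝ) :
    critMass σ Ω u =
      eLpNorm u (ENNReal.ofReal (critExp n σ)) (volume.restrict Ω) ^ critExp n σ := by
  rw [eLpNorm_eq_lintegral_rpow_enorm_toReal (by simpa using hp) ENNReal.ofReal_ne_top,
    ENNReal.toReal_ofReal hp.le, ← ENNReal.rpow_mul, one_div_mul_cancel hp.ne', ENNReal.rpow_one]
  refine lintegral_congr fun x => ?_
  rw [← ENNReal.ofReal_rpow_of_nonneg (abs_nonneg _) hp.le, Real.enorm_eq_ofReal_abs]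

lemma two_le_critExp (hn : 2 ≤ n) (hσ : 0 < σ) (hσ' : σ < 1) : 2 ≤ critExp n σ := by
  have : (2 : ℝ) ≤ n := by exact_mod_cast hn
  rw [critExp, le_div_iff₀ (by linarith)]
  linarith

/-- The test functions approximating a minimizer can be chosen to converge almost everywhere, with
masses tending to that of the minimizer. -/
lemma IsMinimizer.exists_seq (hn : 2 ≤ n) (hσ : 0 < σ) (hσ' : σ < 1)
    {u : EuclideanSpace ℝ (Fin n) → ℝ} (hu : IsMinimizer σ Ω u) (hum : Measurable u) :
    ∃ φ : ℕ → EuclideanSpace ℝ (Fin n) → ℝ, (∀ k, IsTestFunction Ω (φ k)) ∧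
      Tendsto (fun k => energy σ Ω (fun x => φ k x - u x)) atTop (𝓝 0) ∧
      Tendsto (fun k => critMass σ Ω (φ k)) atTop (𝓝 1) ∧
      ∀ᵐ x ∂(volume.restrict Ω), Tendsto (fun k => φ k x) atTop (𝓝 (u x)) := by
  obtain ⟨⟨-, φ, hφ, hE, hM⟩, hmass, -⟩ := hu
  have hp : 0 < critExp n σ := critExp_pos hn hσ'
  set p := critExp n σ with hpdef
  set P : ℝ≥0∞ := ENNReal.ofReal p with hP
  have hP1 : 1 ≤ P := by
    rw [hP, ENNReal.one_le_ofReal]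
    linarith [two_le_critExp hn hσ hσ']
  have hφm : ∀ k, Measurable (φ k) := fun k => (hφ k).1.continuous.measurable
  have hroot : ∀ w, eLpNorm w P (volume.restrict Ω) = critMass σ Ω w ^ (1 / p) := by
    intro w
    rw [critMass_eq_eLpNorm hp, ← ENNReal.rpow_mul, mul_one_div_cancel hp.ne', ENNReal.rpow_one]
  have hLp : Tendsto (fun k => eLpNorm (φ k - u) P (volume.restrict Ω)) atTop (𝓝 0) := by
    simp only [hroot]
    have h := hM.ennrpow_const (1 / p)
    rwa [ENNReal.zero_rpow_of_pos (by positivity)] at h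
  have hu1 : eLpNorm u P (volume.restrict Ω) = 1 := by rw [hroot, hmass, ENNReal.one_rpow]
  have hnorm : Tendsto (fun k => eLpNorm (φ k) P (volume.restrict Ω)) atTop (𝓝 1) := by
    refine tendsto_of_tendsto_of_tendsto_of_le_of_le
      (g := fun k => 1 - eLpNorm (φ k - u) P (volume.restrict Ω))
      (h := fun k => eLpNorm (φ k - u) P (volume.restrict Ω) + 1) ?_ ?_ (fun k => ?_) fun k => ?_
    · have h := ENNReal.Tendsto.sub (tendsto_const_nhds (x := (1 : ℝ≥0∞))) hLp
        (Or.inl ENNReal.one_ne_top)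
      rwa [tsub_zero] at h
    · simpa using hLp.add_const 1
    · rw [tsub_le_iff_left, ← hu1]
      have h := eLpNorm_sub_le (p := P) (μ := volume.restrict Ω) (f := φ k) (g := φ k - u)
        (hφm k).aestronglyMeasurable ((hφm k).sub hum).aestronglyMeasurable hP1
      rwa [sub_sub_cancel, add_comm] at h
    · rw [← hu1]
      have h := eLpNorm_add_le (p := P) (μ := volume.restrict Ω) (f := φ k - u) (g := u)
        ((hφm k).sub hum).aestronglyMeasurable hum.aestronglyMeasurable hP1
      rwa [sub_add_cancel] at h
  have hmass1 : Tendsto (fun k => critMass σ Ω (φ k)) atTop (𝓝 1) := by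
    have h := hnorm.ennrpow_const p
    rw [ENNReal.one_rpow] at h
    exact h.congr fun k => (critMass_eq_eLpNorm hp (φ k)).symm
  obtain ⟨ns, hns, hae⟩ := (tendstoInMeasure_of_tendsto_eLpNorm (zero_lt_one.trans_le hP1).ne'
    (fun k => (hφm k).aestronglyMeasurable) hum.aestronglyMeasurable hLp).exists_seq_tendsto_ae
  exact ⟨fun k => φ (ns k), fun k => hφ _, hE.comp hns.tendsto_atTop,
    hmass1.comp hns.tendsto_atTop, hae⟩

variable {e : EuclideanSpace ℝ (Fin n)} {t : ℝ}

/-- The Sobolev inequality for the polarization of a test function: it leaves room for the gap. -/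
lemma IsTestFunction.sharpConst_mul_add_gap_le (hn : 2 ≤ n) (hσ : 0 < σ) (hσ' : σ < 1)
    (hΩ : IsOpen Ω) (he : ‖e‖ = 1) (hre : planeRefl e t ⁻¹' Ω = Ω)
    {φ : EuclideanSpace ℝ (Fin n) → ℝ} (hφ : IsTestFunction Ω φ) (hm : critMass σ Ω φ ≠ 0) :
    4 * (sharpConst σ Ω * critMass σ Ω φ ^ (2 / critExp n σ)) +
        ∫⁻ x in Ω, ∫⁻ y in Ω, ENNReal.ofReal (gap (n + 2 * σ) e t φ x y) ≤
      4 * energy σ Ω φ := by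
  obtain ⟨K, hK⟩ := hφ.1.lipschitzWith_of_hasCompactSupport hφ.2.1 (by simp)
  have hL : ∀ x y, |φ x - φ y| ≤ K * ‖x - y‖ := fun x y => by
    simpa only [Real.norm_eq_abs] using hK.norm_sub_le x y
  have hL' := abs_polarize_sub_le (t := t) he K.coe_nonneg hL
  have hcont : Continuous (polarize e t φ) :=
    (LipschitzWith.of_dist_le_mul (K := K) fun x y => by
      rw [Real.dist_eq, dist_eq_norm]; exact hL' x y).continuous
  -- the support of the polarization lies in the union of the support and its mirror image
  have hcomp : IsCompact (tsupport φ ∪ planeRefl e t ⁻¹' tsupport φ) := by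
    refine hφ.2.1.isCompact.union ?_
    rw [← (planeRefl_involutive he).image_eq_preimage_symm]
    exact hφ.2.1.isCompact.image continuous_planeRefl
  have hzero : ∀ x ∉ tsupport φ ∪ planeRefl e t ⁻¹' tsupport φ, polarize e t φ x = 0 := by
    intro x hx
    simp only [Set.mem_union, Set.mem_preimage, not_or] at hx
    simp [polarize, image_eq_zero_of_notMem_tsupport hx.1, image_eq_zero_of_notMem_tsupport hx.2]
  have hts : tsupport (polarize e t φ) ⊆ Ω := by
    refine (closure_minimal (fun x hx => ?_) hcomp.isClosed).trans
      (Set.union_subset hφ.2.2 ((Set.preimage_mono hφ.2.2).trans hre.le))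
    by_contra h
    exact hx (hzero x h)
  have hφm : Measurable φ := hφ.1.continuous.measurable
  have hmass := critMass_polarize he hre σ hφm
  have hS := sharpConst_mul_le_of_lipschitz hn hσ hσ' hΩ hcont
    (HasCompactSupport.intro hcomp hzero) hts K.coe_nonneg hL' (by rwa [hmass])
  rw [hmass] at hS
  refine le_trans ?_ (four_mul_energy_polarize_add_le he hre hσ.le hφm)
  gcongr

lemma IsTestFunction.energy_ne_top (hn : 2 ≤ n) (hσ : 0 < σ) (hσ' : σ < 1)
    {φ : EuclideanSpace ℝ (Fin n) → ℝ} (hφ : IsTestFunction Ω φ) : energy σ Ω φ ≠ ⊤ := by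
  obtain ⟨K, hK⟩ := hφ.1.lipschitzWith_of_hasCompactSupport hφ.2.1 (by simp)
  obtain ⟨M, hM⟩ := hφ.2.1.exists_bound_of_continuous hφ.1.continuous
  exact RegionalSobolev.energy_ne_top (by omega) hσ hσ' hφ.1.continuous (L := K)
    (fun x y => by simpa only [Real.norm_eq_abs] using hK.norm_sub_le x y) hM hφ.2.1
    fun x hx => image_eq_zero_of_notMem_tsupport hx

/-- Polarization cannot decrease the energy of a minimizer. -/
lemma IsMinimizer.lintegral_gap_eq_zero (hn : 2 ≤ n) (hσ : 0 < σ) (hσ' : σ < 1)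
    (hΩ : IsOpen Ω) (he : ‖e‖ = 1) (hre : planeRefl e t ⁻¹' Ω = Ω)
    {u : EuclideanSpace ℝ (Fin n) → ℝ} (hu : IsMinimizer σ Ω u) (hum : Measurable u) :
    ∫⁻ z, ENNReal.ofReal (gap (n + 2 * σ) e t u z.1 z.2)
      ∂((volume.restrict Ω).prod (volume.restrict Ω)) = 0 := by
  obtain ⟨φ, hφ, hE, hM, hae⟩ := hu.exists_seq hn hσ hσ' hum
  have hp : 0 < critExp n σ := critExp_pos hn hσ'
  have hp2 : 0 < 2 / critExp n σ := by positivity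
  have hφm : ∀ k, Measurable (φ k) := fun k => (hφ k).1.continuous.measurable
  set S := sharpConst σ Ω with hSdef
  have hne : ∀ᶠ k in atTop, critMass σ Ω (φ k) ≠ 0 := hM.eventually_ne one_ne_zero
  have hgap := fun (k : ℕ) => (hφ k).sharpConst_mul_add_gap_le hn hσ hσ' hΩ he hre
  have hStop : S ≠ ⊤ := by
    obtain ⟨k, hk⟩ := hne.exists
    intro hS
    have h := le_self_add.trans (hgap k hk)
    have h0 : critMass σ Ω (φ k) ^ (2 / critExp n σ) ≠ 0 := by
      simp [ENNReal.rpow_eq_zero_iff, hk, hp2.le]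
    rw [← hSdef, hS, ENNReal.top_mul h0, ENNReal.mul_top (by norm_num), top_le_iff] at h
    exact ENNReal.mul_ne_top (by norm_num) ((hφ k).energy_ne_top hn hσ hσ') h
  have hD : Tendsto (fun k => ∫⁻ z, ENNReal.ofReal (gap (n + 2 * σ) e t (φ k) z.1 z.2)
      ∂((volume.restrict Ω).prod (volume.restrict Ω))) atTop (𝓝 0) := by
    have hupper : Tendsto (fun k => 4 * (energy σ Ω (fun x => φ k x - u x) ^ (1 / 2 : ℝ) +
        S ^ (1 / 2 : ℝ)) ^ (2 : ℝ)) atTop (𝓝 (4 * S)) := by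
      have h := ((hE.ennrpow_const (1 / 2 : ℝ)).add_const (S ^ (1 / 2 : ℝ))).ennrpow_const (2 : ℝ)
      rw [ENNReal.zero_rpow_of_pos (by norm_num), zero_add, ← ENNReal.rpow_mul] at h
      norm_num at h
      have h' := ENNReal.Tendsto.const_mul (a := 4) h (Or.inr (by norm_num))
      simpa using h'
    have hlower : Tendsto (fun k => 4 * (S * critMass σ Ω (φ k) ^ (2 / critExp n σ))) atTop
        (𝓝 (4 * S)) := by
      have h := ENNReal.Tendsto.const_mul (hM.ennrpow_const (2 / critExp n σ))
        (Or.inr hStop)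
      rw [ENNReal.one_rpow, mul_one] at h
      exact ENNReal.Tendsto.const_mul h (Or.inr (by norm_num))
    have hdiff := ENNReal.Tendsto.sub hupper hlower
      (Or.inl (ENNReal.mul_ne_top (by norm_num) hStop))
    rw [tsub_self] at hdiff
    refine tendsto_of_tendsto_of_tendsto_of_le_of_le' tendsto_const_nhds hdiff
      (Eventually.of_forall fun _ => zero_le) ?_
    filter_upwards [hne, hM.eventually_ne ENNReal.one_ne_top] with k hk hk'
    rw [lintegral_prod _ (measurable_gap _ (hφm k)).ennreal_ofReal.aemeasurable]
    have hfin : 4 * (S * critMass σ Ω (φ k) ^ (2 / critExp n σ)) ≠ ⊤ :=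
      ENNReal.mul_ne_top (by norm_num) (ENNReal.mul_ne_top hStop
        (ENNReal.rpow_ne_top_of_nonneg hp2.le hk'))
    refine ENNReal.le_sub_of_add_le_left hfin ((hgap k hk).trans ?_)
    have h := energy_rpow_half_le (σ := σ) (Ω := Ω) hum (hφm k)
    rw [hu.2.2] at h
    gcongr
    calc energy σ Ω (φ k) = (energy σ Ω (φ k) ^ (1 / 2 : ℝ)) ^ (2 : ℝ) := by
          rw [← ENNReal.rpow_mul]; norm_num
      _ ≤ _ := ENNReal.rpow_le_rpow h (by norm_num)
  have hae' : ∀ᵐ x ∂(volume.restrict Ω),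
      Tendsto (fun k => φ k (planeRefl e t x)) atTop (𝓝 (u (planeRefl e t x))) := by
    have hmp : MeasurePreserving (planeRefl e t) (volume.restrict Ω) (volume.restrict Ω) := by
      have h := (measurePreserving_planeRefl (t := t) he).restrict_preimage hΩ.measurableSet
      rwa [hre] at h
    exact hmp.quasiMeasurePreserving.ae hae
  have hlim : ∀ᵐ z ∂((volume.restrict Ω).prod (volume.restrict Ω)),
      Tendsto (fun k => ENNReal.ofReal (gap (n + 2 * σ) e t (φ k) z.1 z.2)) atTop
        (𝓝 (ENNReal.ofReal (gap (n + 2 * σ) e t u z.1 z.2))) := by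
    filter_upwards [Measure.quasiMeasurePreserving_fst.ae hae,
      Measure.quasiMeasurePreserving_fst.ae hae', Measure.quasiMeasurePreserving_snd.ae hae,
      Measure.quasiMeasurePreserving_snd.ae hae'] with z h1 h2 h3 h4
    refine ENNReal.tendsto_ofReal ?_
    unfold gap
    split_ifs
    · exact (tendsto_const_nhds.max ((h1.sub h2).mul (h3.sub h4)).neg).const_mul _
    · exact tendsto_const_nhds
  refine le_antisymm ?_ zero_le
  calc ∫⁻ z, ENNReal.ofReal (gap (n + 2 * σ) e t u z.1 z.2)
        ∂((volume.restrict Ω).prod (volume.restrict Ω))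
      = ∫⁻ z, liminf (fun k => ENNReal.ofReal (gap (n + 2 * σ) e t (φ k) z.1 z.2)) atTop
          ∂((volume.restrict Ω).prod (volume.restrict Ω)) :=
        lintegral_congr_ae (hlim.mono fun z hz => hz.liminf_eq.symm)
    _ ≤ liminf (fun k => ∫⁻ z, ENNReal.ofReal (gap (n + 2 * σ) e t (φ k) z.1 z.2)
          ∂((volume.restrict Ω).prod (volume.restrict Ω))) atTop :=
        lintegral_liminf_le fun k => (measurable_gap _ (hφm k)).ennreal_ofReal
    _ = 0 := hD.liminf_eq

/-- A minimizer and its mirror image are ordered on each side of the mirror. -/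
lemma IsMinimizer.ae_le_or_ae_ge (hn : 2 ≤ n) (hσ : 0 < σ) (hσ' : σ < 1)
    (hΩ : IsOpen Ω) (he : ‖e‖ = 1) (hre : planeRefl e t ⁻¹' Ω = Ω)
    {u : EuclideanSpace ℝ (Fin n) → ℝ} (hu : IsMinimizer σ Ω u) (hum : Measurable u) :
    (∀ᵐ x ∂(volume.restrict Ω), 0 < height e t x → u (planeRefl e t x) ≤ u x) ∨
      ∀ᵐ x ∂(volume.restrict Ω), 0 < height e t x → u x ≤ u (planeRefl e t x) := by
  have : Nonempty (Fin n) := ⟨⟨0, by omega⟩⟩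
  have h := hu.lintegral_gap_eq_zero hn hσ hσ' hΩ he hre hum
  rw [lintegral_eq_zero_iff (measurable_gap _ hum).ennreal_ofReal] at h
  have h2 := Measure.ae_ae_of_ae_prod h
  by_cases hA : ∀ᵐ x ∂(volume.restrict Ω), 0 < height e t x → u (planeRefl e t x) ≤ u x
  · exact Or.inl hA
  right
  obtain ⟨x, hx, hgx⟩ := ((not_eventually.1 hA).and_eventually h2).exists
  push Not at hx
  have hne : ∀ᵐ y ∂(volume.restrict Ω), y ≠ x := Measure.ae_ne _ x
  filter_upwards [hgx, hne] with y hy hyx hy0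
  simp only [Pi.zero_apply, ENNReal.ofReal_eq_zero] at hy
  rw [gap, if_pos ⟨hx.1, hy0⟩] at hy
  have hpos : 0 < ‖x - y‖ := norm_pos_iff.2 (sub_ne_zero.2 hyx.symm)
  have hq : 0 < (n : ℝ) + 2 * σ := by positivity
  have hK : 1 / ‖x - planeRefl e t y‖ ^ ((n : ℝ) + 2 * σ) < 1 / ‖x - y‖ ^ ((n : ℝ) + 2 * σ) :=
    one_div_lt_one_div_of_lt (Real.rpow_pos_of_pos hpos _) (Real.rpow_lt_rpow hpos.le
      (norm_sub_lt_norm_sub_planeRefl he (mul_pos hx.1 hy0)) hq)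
  by_contra! hlt
  have h3 : 0 < -((u x - u (planeRefl e t x)) * (u y - u (planeRefl e t y))) := by
    nlinarith [mul_pos (sub_pos.2 hx.2) (sub_pos.2 hlt)]
  exact absurd hy (not_le.2 (mul_pos (by linarith) (lt_max_of_lt_right h3)))

end Minimizer

/-! ### Functions in `L ^ p` that are ordered with their mirror images -/

section Mirror

variable {V : Type*} [NormedAddCommGroup V] [InnerProductSpace ℝ V] [FiniteDimensional ℝ V]
  [MeasurableSpace V] [BorelSpace V] {e : V} {t : ℝ}

lemma tendsto_lintegral_halfSpace_zero {f : V → ℝ≥0∞} (hf : Measurable f) (hfin : ∫⁻ x, f x ≠ ⊤)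
    (v : V) {c : ℕ → ℝ} (hc : Tendsto c atTop atBot) :
    Tendsto (fun k => ∫⁻ x in {x | inner ℝ v x ≤ c k}, f x) atTop (𝓝 0) := by
  have hm : ∀ k, MeasurableSet {x : V | inner ℝ v x ≤ c k} := fun k =>
    measurableSet_le (by fun_prop) measurable_const
  simp only [← lintegral_indicator (hm _)]
  rw [← lintegral_zero (α := V) (μ := volume)]
  refine tendsto_lintegral_of_dominated_convergence f (fun k => hf.indicator (hm k))
    (fun k => Eventually.of_forall fun x => Set.indicator_le_self _ _ _) hfin
    (Eventually.of_forall fun x => tendsto_const_nhds.congr' ?_)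
  filter_upwards [hc.eventually_lt_atBot (inner ℝ v x)] with k hk
  rw [Set.indicator_of_notMem (by simpa using hk)]

/-- An integrable function that increases under every reflection from the positive side of a
hyperplane orthogonal to `e` vanishes: as the hyperplane moves off to `-∞`, all its mass would have
to lie behind it. -/
lemma ae_eq_zero_of_le_planeRefl (he : ‖e‖ = 1) {f : V → ℝ≥0∞} (hf : Measurable f)
    (hfin : ∫⁻ x, f x ≠ ⊤)
    (h : ∀ t, ∀ᵐ x : V, 0 < height e t x → f x ≤ f (planeRefl e t x)) : f =ᵐ[volume] 0 := by
  have key : ∀ t : ℝ, ∫⁻ x, f x ≤ 2 * ∫⁻ x in {x | inner ℝ e x ≤ t}, f x := by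
    intro t
    have hm : MeasurableSet {x : V | inner ℝ e x ≤ t} :=
      measurableSet_le (by fun_prop) measurable_const
    have h1 : ∫⁻ x in {x : V | inner ℝ e x ≤ t}ᶜ, f x ≤
        ∫⁻ x in {x : V | inner ℝ e x ≤ t}, f x := by
      calc ∫⁻ x in {x : V | inner ℝ e x ≤ t}ᶜ, f x
          ≤ ∫⁻ x in {x : V | inner ℝ e x ≤ t}ᶜ, f (planeRefl e t x) := by
            refine lintegral_mono_ae ?_
            filter_upwards [ae_restrict_mem hm.compl, ae_restrict_of_ae (h t)] with x hx hx'
            refine hx' ?_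
            simp only [Set.mem_compl_iff, Set.mem_ofPred_eq, not_le] at hx
            simpa [height] using hx
        _ ≤ ∫⁻ x in planeRefl e t ⁻¹' {x : V | inner ℝ e x ≤ t}, f (planeRefl e t x) := by
            refine lintegral_mono_set fun x hx => ?_
            have hh := height_planeRefl (t := t) he x
            simp only [Set.mem_compl_iff, Set.mem_ofPred_eq, not_le, height] at hx hh
            simp only [Set.mem_preimage, Set.mem_ofPred_eq]
            linarith
        _ = ∫⁻ x in {x : V | inner ℝ e x ≤ t}, f x :=
            (measurePreserving_planeRefl he).setLIntegral_comp_preimage_emb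
              (measurableEmbedding_planeRefl he) f _
    rw [← lintegral_add_compl f hm, two_mul]
    gcongr
  have h0 : Tendsto (fun k : ℕ => 2 * ∫⁻ x in {x | inner ℝ e x ≤ -(k : ℝ)}, f x) atTop (𝓝 0) := by
    have := ENNReal.Tendsto.const_mul (a := 2) (tendsto_lintegral_halfSpace_zero hf hfin e
      (tendsto_neg_atTop_atBot.comp tendsto_natCast_atTop_atTop)) (Or.inr (by norm_num))
    simpa using this
  rw [← lintegral_eq_zero_iff hf]
  exact le_antisymm (ge_of_tendsto' h0 fun k => key _) zero_le

/-- An integrable function invariant under a nonzero translation vanishes. -/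
lemma ae_eq_zero_of_add_eq {f : V → ℝ≥0∞} (hf : Measurable f) (hfin : ∫⁻ x, f x ≠ ⊤) {v : V}
    (hv : v ≠ 0) (h : ∀ᵐ x : V, f (x + v) = f x) : f =ᵐ[volume] 0 := by
  have hstep : ∀ c : ℝ, ∫⁻ x in {x : V | inner ℝ v x ≤ c}, f x =
      ∫⁻ x in {x : V | inner ℝ v x ≤ c - ‖v‖ ^ 2}, f x := by
    intro c
    rw [← (measurePreserving_add_right volume v).setLIntegral_comp_preimage_emb
      (measurableEmbedding_addRight v) f]
    have hset : (fun x => x + v) ⁻¹' {x : V | inner ℝ v x ≤ c} =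
        {x : V | inner ℝ v x ≤ c - ‖v‖ ^ 2} := by
      ext x
      simp only [Set.mem_preimage, Set.mem_ofPred_eq, inner_add_right, real_inner_self_eq_norm_sq,
        le_sub_iff_add_le]
    rw [hset]
    exact lintegral_congr_ae (ae_restrict_of_ae h)
  have hstep' : ∀ (c : ℝ) (k : ℕ), ∫⁻ x in {x : V | inner ℝ v x ≤ c}, f x =
      ∫⁻ x in {x : V | inner ℝ v x ≤ c - k * ‖v‖ ^ 2}, f x := by
    intro c k
    induction k with
    | zero => simp
    | succ k ih =>
      rw [ih, hstep]
      congr! 5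
      push_cast
      ring
  have hzero : ∀ c : ℝ, ∫⁻ x in {x : V | inner ℝ v x ≤ c}, f x = 0 := by
    intro c
    have hc : Tendsto (fun k : ℕ => c - k * ‖v‖ ^ 2) atTop atBot := by
      refine tendsto_const_nhds.add_atBot (tendsto_neg_atTop_atBot.comp ?_)
      exact tendsto_natCast_atTop_atTop.atTop_mul_const (by positivity)
    have h1 := tendsto_lintegral_halfSpace_zero hf hfin v hc
    simp only [← hstep' c] at h1
    exact tendsto_nhds_unique tendsto_const_nhds h1
  have hall : ∀ᵐ x : V, ∀ k : ℕ, inner ℝ v x ≤ k → f x = 0 := by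
    refine ae_all_iff.2 fun k => ?_
    have hm : MeasurableSet {x : V | inner ℝ v x ≤ k} :=
      measurableSet_le (by fun_prop) measurable_const
    exact (ae_restrict_iff' hm).1 ((lintegral_eq_zero_iff hf).1 (hzero k))
  filter_upwards [hall] with x hx
  obtain ⟨k, hk⟩ := exists_nat_ge (inner ℝ v x : ℝ)
  exact hx k hk

variable {p : ℝ≥0∞} {u : V → ℝ}

lemma lintegral_ofReal_rpow_ne_top (hp0 : p ≠ 0) (hp : p ≠ ⊤) (hu : MemLp u p) :
    ∫⁻ x, ENNReal.ofReal (u x) ^ p.toReal ≠ ⊤ := by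
  have h := lintegral_rpow_enorm_lt_top_of_eLpNorm_lt_top hp0 hp hu.eLpNorm_lt_top
  refine ne_top_of_le_ne_top h.ne (lintegral_mono fun x => ?_)
  rw [Real.enorm_eq_ofReal_abs]
  gcongr
  exact le_abs_self _

/-- A function in `L ^ p` cannot lie above its mirror image on the positive side of every hyperplane
orthogonal to `e`, unless it vanishes. -/
lemma ae_eq_zero_of_forall_planeRefl_le (he : ‖e‖ = 1) (hp0 : p ≠ 0) (hp : p ≠ ⊤)
    (hum : Measurable u) (hu : MemLp u p)
    (h : ∀ t, ∀ᵐ x : V, 0 < height e t x → u (planeRefl e t x) ≤ u x) : u =ᵐ[volume] 0 := by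
  have hp' : 0 < p.toReal := ENNReal.toReal_pos hp0 hp
  have hneg : (fun x => ENNReal.ofReal (-u x) ^ p.toReal) =ᵐ[volume] 0 := by
    refine ae_eq_zero_of_le_planeRefl he (by fun_prop)
      (lintegral_ofReal_rpow_ne_top hp0 hp hu.neg) fun t => ?_
    filter_upwards [h t] with x hx h0
    have := hx h0
    gcongr
  -- the same for the positive part, with the roles of the two sides exchanged
  have hpos : (fun x => ENNReal.ofReal (u x) ^ p.toReal) =ᵐ[volume] 0 := by
    refine ae_eq_zero_of_le_planeRefl (e := -e) (by rwa [norm_neg]) (by fun_prop)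
      (lintegral_ofReal_rpow_ne_top hp0 hp hu) fun t => ?_
    have ht := (measurePreserving_planeRefl (t := -t) he).quasiMeasurePreserving.ae (h (-t))
    filter_upwards [ht] with x hx h0
    have h1 := height_neg_neg (e := e) (t := -t) x
    have h2 := planeRefl_neg_neg (e := e) (t := -t) x
    rw [neg_neg] at h1 h2
    rw [height_planeRefl he, planeRefl_planeRefl he] at hx
    rw [h1] at h0
    have := hx h0
    rw [h2]
    gcongr
  filter_upwards [hneg, hpos] with x h1 h2
  simp only [Pi.zero_apply, ENNReal.rpow_eq_zero_iff_of_pos hp', ENNReal.ofReal_eq_zero] at h1 h2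
  exact le_antisymm h2 (neg_nonpos.1 h1)

/-- The hyperplanes above which a function in `L ^ p` dominates its mirror image form a closed set,
because reflections act continuously on `L ^ p`. -/
lemma isClosed_setOf_planeRefl_le (he : ‖e‖ = 1) (hp1 : 1 ≤ p) (hp : p ≠ ⊤) (hu : MemLp u p) :
    IsClosed {t : ℝ | ∀ᵐ x : V, 0 < height e t x → u (planeRefl e t x) ≤ u x} := by
  have : Fact (1 ≤ p) := ⟨hp1⟩
  refine IsSeqClosed.isClosed fun s t hs hst => ?_
  let g : ℝ → C(V, V) := fun t => ⟨planeRefl e t, continuous_planeRefl⟩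
  have hg : Continuous g := by
    refine ContinuousMap.continuous_of_continuous_uncurry _ ?_
    simp only [g, Function.uncurry_def, ContinuousMap.coe_mk, planeRefl, height]
    fun_prop
  have hgm : ∀ t, MeasurePreserving (g t) (volume : Measure V) volume :=
    fun t => measurePreserving_planeRefl he
  have hG : Continuous fun t => Lp.compMeasurePreserving (g t) (hgm t) (hu.toLp u) :=
    continuous_const.compMeasurePreservingLp hg hgm hp
  have hlim := tendstoInMeasure_of_tendsto_Lp ((hG.tendsto t).comp hst)
  obtain ⟨ns, hns, hae⟩ := hlim.exists_seq_tendsto_ae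
  have hval : ∀ t, Lp.compMeasurePreserving (g t) (hgm t) (hu.toLp u) =ᵐ[volume]
      fun x => u (planeRefl e t x) := by
    intro t
    rw [Lp.toLp_compMeasurePreserving]
    exact MemLp.coeFn_toLp _
  filter_upwards [hae, hval t, ae_all_iff.2 fun k => hval (s (ns k)),
    ae_all_iff.2 fun k => hs (ns k)] with x hx hxt hxs hxk h0
  simp only [Function.comp_apply, hxs, hxt] at hx
  refine le_of_tendsto hx ?_
  have hh : Tendsto (fun k => height e (s (ns k)) x) atTop (𝓝 (height e t x)) :=
    (hst.comp hns.tendsto_atTop).const_sub _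
  filter_upwards [hh.eventually (lt_mem_nhds h0)] with k hk using hxk k hk

/-- If a nonzero function in `L ^ p` is ordered with its mirror image for each hyperplane orthogonal
to `e`, then it is symmetric about one of these hyperplanes. -/
lemma exists_planeRefl_ae_eq (he : ‖e‖ = 1) (hp1 : 1 ≤ p) (hp : p ≠ ⊤)
    (hum : Measurable u) (hu : MemLp u p) (hu0 : ¬ u =ᵐ[volume] 0)
    (h : ∀ t, (∀ᵐ x : V, 0 < height e t x → u (planeRefl e t x) ≤ u x) ∨
      ∀ᵐ x : V, 0 < height e t x → u x ≤ u (planeRefl e t x)) :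
    ∃ t, ∀ᵐ x : V, u (planeRefl e t x) = u x := by
  have hp0 : p ≠ 0 := (zero_lt_one.trans_le hp1).ne'
  set A := {t : ℝ | ∀ᵐ x : V, 0 < height e t x → u (planeRefl e t x) ≤ u x} with hA
  set B := {t : ℝ | ∀ᵐ x : V, 0 < height e t x → u x ≤ u (planeRefl e t x)} with hB
  have hAc : IsClosed A := isClosed_setOf_planeRefl_le he hp1 hp hu
  have hBc : IsClosed B := by
    have := isClosed_setOf_planeRefl_le he hp1 hp hu.neg
    simpa only [Pi.neg_apply, neg_le_neg_iff] using this
  have hAne : A.Nonempty := by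
    by_contra hne
    rw [Set.not_nonempty_iff_eq_empty] at hne
    refine hu0 ?_
    have hz : -u =ᵐ[volume] 0 := ae_eq_zero_of_forall_planeRefl_le he hp0 hp hum.neg hu.neg
      fun t => by
        simpa only [Pi.neg_apply, neg_le_neg_iff] using
          (h t).resolve_left fun ht => (hne ▸ ht : t ∈ (∅ : Set ℝ))
    filter_upwards [hz] with x hx
    simpa using hx
  have hBne : B.Nonempty := by
    by_contra hne
    rw [Set.not_nonempty_iff_eq_empty] at hne
    exact hu0 (ae_eq_zero_of_forall_planeRefl_le he hp0 hp hum hu fun t =>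
      (h t).resolve_right fun ht => (hne ▸ ht : t ∈ (∅ : Set ℝ)))
  obtain ⟨t, -, htA, htB⟩ := isPreconnected_closed_iff.1 isPreconnected_univ A B hAc hBc
    (fun t _ => h t) (by simpa using hAne) (by simpa using hBne)
  refine ⟨t, ?_⟩
  have hqmp := (measurePreserving_planeRefl (t := t) he).quasiMeasurePreserving
  filter_upwards [htA, htB, hqmp.ae htA, hqmp.ae htB] with x h1 h2 h3 h4
  rw [height_planeRefl he, planeRefl_planeRefl he] at h3 h4
  rcases lt_trichotomy (height e t x) 0 with h0 | h0 | h0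
  · exact le_antisymm (h4 (by linarith)) (h3 (by linarith))
  · rw [planeRefl_of_height_eq_zero h0]
  · exact le_antisymm (h1 h0) (h2 h0)

/-- The limit of the averages of `u` over shrinking balls: a representative of `u` that has every
symmetry of `u` at each point, not only almost everywhere. -/
def preciseRep (u : V → ℝ) (x : V) : ℝ :=
  limUnder atTop fun k : ℕ => ⨍ y in Metric.closedBall x (1 / ((k : ℝ) + 1)), u y

lemma preciseRep_ae_eq (hu : LocallyIntegrable u) : preciseRep u =ᵐ[volume] u := by
  filter_upwards [(Besicovitch.vitaliFamily (volume : Measure V)).ae_tendsto_average hu] with x hx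
  have h0 : Tendsto (fun k : ℕ => 1 / ((k : ℝ) + 1)) atTop (𝓝[>] 0) :=
    tendsto_nhdsWithin_iff.2 ⟨tendsto_one_div_add_atTop_nhds_zero_nat,
      Eventually.of_forall fun k => Set.mem_Ioi.2 (by positivity)⟩
  exact ((hx.comp (Besicovitch.tendsto_filterAt volume x)).comp h0).limUnder_eq

lemma preciseRep_planeRefl (he : ‖e‖ = 1) (h : ∀ᵐ x : V, u (planeRefl e t x) = u x) (x : V) :
    preciseRep u (planeRefl e t x) = preciseRep u x := by
  unfold preciseRep
  congr 1
  ext k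
  rw [setAverage_eq, setAverage_eq]
  have hpre : planeRefl e t ⁻¹' Metric.closedBall (planeRefl e t x) (1 / ((k : ℝ) + 1)) =
      Metric.closedBall x (1 / ((k : ℝ) + 1)) := (isometry_planeRefl he).preimage_closedBall _ _
  congr 1
  · rw [measureReal_def, measureReal_def, Measure.addHaar_closedBall_center,
      Measure.addHaar_closedBall_center volume x]
  · rw [← (measurePreserving_planeRefl he).setIntegral_preimage_emb
      (measurableEmbedding_planeRefl he), hpre]
    exact integral_congr_ae (ae_restrict_of_ae h)

end Mirror

/-! ### The half-space -/

section HalfSpace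

variable {n : ℕ} (hn : 2 ≤ n)

lemma isOpen_halfSpace : IsOpen (halfSpace hn) := by
  unfold halfSpace lastCoord
  exact isOpen_lt continuous_const (by fun_prop)

lemma sq_norm_eq_firstCoords_add_lastCoord (x : EuclideanSpace ℝ (Fin n)) :
    ‖x‖ ^ 2 = ‖firstCoords x‖ ^ 2 + lastCoord hn x ^ 2 := by
  obtain ⟨m, rfl⟩ : ∃ m, n = m + 1 := ⟨n - 1, by omega⟩
  rw [EuclideanSpace.real_norm_sq_eq, EuclideanSpace.real_norm_sq_eq, Fin.sum_univ_castSucc]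
  rfl

variable {e : EuclideanSpace ℝ (Fin n)} {t : ℝ}

lemma lastCoord_planeRefl (he : lastCoord hn e = 0) (x : EuclideanSpace ℝ (Fin n)) :
    lastCoord hn (planeRefl e t x) = lastCoord hn x := by
  simp only [lastCoord] at he ⊢
  simp [planeRefl, he]

lemma planeRefl_preimage_halfSpace (he : lastCoord hn e = 0) :
    planeRefl e t ⁻¹' halfSpace hn = halfSpace hn := by
  ext x
  simp [halfSpace, lastCoord_planeRefl hn he]

lemma planeRefl_single_apply (j : Fin n) (x : EuclideanSpace ℝ (Fin n)) (i : Fin n) :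
    planeRefl (EuclideanSpace.single j 1) t x i = if i = j then 2 * t - x j else x i := by
  have h : inner ℝ (EuclideanSpace.single j (1 : ℝ)) x = x j := by
    simp [EuclideanSpace.inner_single_left]
  rw [planeRefl, height, h]
  split_ifs with hij
  · subst hij
    simp
    ring
  · simp [hij]

/-- The reflection of `x` through `a` in all coordinates but the last. -/
def pointRefl (a x : EuclideanSpace ℝ (Fin n)) : EuclideanSpace ℝ (Fin n) :=
  WithLp.toLp 2 fun i => if i = ⟨n - 1, by omega⟩ then x i else 2 * a i - x i

/-- The point reflection is the product of the reflections in the coordinate hyperplanes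
through `a`. -/
lemma apply_pointRefl {W : EuclideanSpace ℝ (Fin n) → ℝ} {a : EuclideanSpace ℝ (Fin n)}
    (h : ∀ i : Fin n, i ≠ ⟨n - 1, by omega⟩ →
      ∀ x, W (planeRefl (EuclideanSpace.single i 1) (a i) x) = W x)
    (x : EuclideanSpace ℝ (Fin n)) : W (pointRefl hn a x) = W x := by
  classical
  have key : ∀ s : Finset (Fin n), (⟨n - 1, by omega⟩ : Fin n) ∉ s →
      W (WithLp.toLp 2 fun i => if i ∈ s then 2 * a i - x i else x i) = W x := by
    intro s
    induction s using Finset.induction_on with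
    | empty => intro _; simp
    | insert j s hj ih =>
      intro hs
      rw [Finset.mem_insert, not_or] at hs
      rw [← ih hs.2, ← h j (Ne.symm hs.1)]
      congr 1
      ext i
      by_cases hij : i = j
      · subst hij
        simp [planeRefl_single_apply, hj]
      · simp [planeRefl_single_apply, hij]
  have := key (Finset.univ.erase ⟨n - 1, by omega⟩) (by simp)
  rw [← this]
  congr 1
  ext i
  simp [pointRefl, ite_not]

lemma planeRefl_pointRefl_planeRefl_pointRefl (he1 : ‖e‖ = 1) (he : lastCoord hn e = 0)
    (a x : EuclideanSpace ℝ (Fin n)) :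
    planeRefl e t (pointRefl hn a (planeRefl e t (pointRefl hn a x))) =
      x + (4 * (t - inner ℝ e a)) • e := by
  have hsub : ∀ (z : EuclideanSpace ℝ (Fin n)) (c : ℝ),
      pointRefl hn a (z - c • e) = pointRefl hn a z + c • e := by
    intro z c
    ext i
    by_cases hi : i = ⟨n - 1, by omega⟩
    · have h0 : e i = 0 := by rw [hi]; exact he
      simp [pointRefl, hi]
      simp [hi ▸ h0]
    · simp [pointRefl, hi]
      ring
  have hinv : ∀ z, pointRefl hn a (pointRefl hn a z) = z := by
    intro z
    ext i
    by_cases hi : i = ⟨n - 1, by omega⟩ <;> simp [pointRefl, hi]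
  have hinner : inner ℝ e (pointRefl hn a x) = 2 * inner ℝ e a - inner ℝ e x := by
    simp only [PiLp.inner_apply, Finset.mul_sum, ← Finset.sum_sub_distrib]
    refine Finset.sum_congr rfl fun i _ => ?_
    by_cases hi : i = ⟨n - 1, by omega⟩
    · have h0 : e i = 0 := by rw [hi]; exact he
      simp [h0]
    · simp [pointRefl, hi]
      ring
  have hee : inner ℝ e e = (1 : ℝ) := by rw [real_inner_self_eq_norm_sq, he1, one_pow]
  conv_lhs => rw [planeRefl.eq_def e t (pointRefl hn a x), hsub, hinv]
  simp only [planeRefl, height, hinner, inner_add_right, inner_smul_right, hee]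
  module

/-- Two points at the same height and at the same horizontal distance from `a` are exchanged by the
reflection in a vertical hyperplane through `a`. -/
lemma exists_planeRefl_eq {a x y : EuclideanSpace ℝ (Fin n)} (hne : x ≠ y)
    (hdist : ‖firstCoords x - firstCoords a‖ = ‖firstCoords y - firstCoords a‖)
    (hlast : lastCoord hn x = lastCoord hn y) :
    ∃ e, ‖e‖ = 1 ∧ lastCoord hn e = 0 ∧ planeRefl e (inner ℝ e a) x = y := by
  have hdist' : ‖x - a‖ ^ 2 = ‖y - a‖ ^ 2 := by
    rw [sq_norm_eq_firstCoords_add_lastCoord hn, sq_norm_eq_firstCoords_add_lastCoord hn (y - a)]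
    have h1 : ∀ z, firstCoords (z - a) = firstCoords z - firstCoords a := fun z => rfl
    have h2 : ∀ z, lastCoord hn (z - a) = lastCoord hn z - lastCoord hn a := fun z => rfl
    rw [h1, h1, h2, h2, hdist, hlast]
  have hpos : 0 < ‖x - y‖ := norm_pos_iff.2 (sub_ne_zero.2 hne)
  have hinner : 2 * inner ℝ (x - y) (x - a) = ‖x - y‖ ^ 2 := by
    have h := norm_sub_sq_real (x - a) (x - y)
    rw [sub_sub_sub_cancel_left, real_inner_comm] at h
    linarith
  refine ⟨‖x - y‖⁻¹ • (x - y), ?_, ?_, ?_⟩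
  · rw [norm_smul, norm_inv, norm_norm, inv_mul_cancel₀ hpos.ne']
  · have h : x ⟨n - 1, by omega⟩ = y ⟨n - 1, by omega⟩ := hlast
    simp [lastCoord, h]
  · have hh : 2 * height (‖x - y‖⁻¹ • (x - y)) (inner ℝ (‖x - y‖⁻¹ • (x - y)) a) x = ‖x - y‖ := by
      rw [height, ← inner_sub_right, real_inner_smul_left, mul_left_comm, hinner]
      field_simp
    rw [planeRefl, hh, smul_smul, mul_inv_cancel₀ hpos.ne', one_smul, sub_sub_cancel]

/-- A function without periods that has a vertical hyperplane of symmetry in every horizontal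
direction depends only on the height and on the horizontal distance from some point. -/
lemma exists_factorsThrough_norm_firstCoords_sub {W : EuclideanSpace ℝ (Fin n) → ℝ}
    (hexists : ∀ e : EuclideanSpace ℝ (Fin n), ‖e‖ = 1 → lastCoord hn e = 0 →
      ∃ t, ∀ x, W (planeRefl e t x) = W x)
    (hper : ∀ v : EuclideanSpace ℝ (Fin n), (∀ x, W (x + v) = W x) → v = 0) :
    ∃ a : EuclideanSpace ℝ (Fin (n - 1)),
      Function.FactorsThrough W fun x => (‖firstCoords x - a‖, lastCoord hn x) := by
  have hcoord : ∀ i : Fin n, ∃ t : ℝ, i ≠ ⟨n - 1, by omega⟩ →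
      ∀ x, W (planeRefl (EuclideanSpace.single i 1) t x) = W x := by
    intro i
    by_cases hi : i = ⟨n - 1, by omega⟩
    · exact ⟨0, fun h => absurd hi h⟩
    · obtain ⟨t, ht⟩ := hexists (EuclideanSpace.single i 1) (by simp)
        (by simp [lastCoord, Ne.symm hi])
      exact ⟨t, fun _ => ht⟩
  choose τ hτ using hcoord
  let a : EuclideanSpace ℝ (Fin n) := WithLp.toLp 2 τ
  have hpoint : ∀ x, W (pointRefl hn a x) = W x := apply_pointRefl hn fun i hi x => hτ i hi x
  -- every vertical hyperplane of symmetry passes through `a`, as otherwise its mirror image under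
  -- the point reflection would be another one, and `W` would be periodic
  have hsymm : ∀ e : EuclideanSpace ℝ (Fin n), ‖e‖ = 1 → lastCoord hn e = 0 →
      ∀ x, W (planeRefl e (inner ℝ e a) x) = W x := by
    intro e he he0
    obtain ⟨t, ht⟩ := hexists e he he0
    have h0 := hper ((4 * (t - inner ℝ e a)) • e) fun x => by
      rw [← planeRefl_pointRefl_planeRefl_pointRefl hn he he0 a x, ht, hpoint, ht, hpoint]
    have he' : e ≠ 0 := norm_ne_zero_iff.1 (by rw [he]; exact one_ne_zero)
    have hta : t = inner ℝ e a := by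
      simpa [he', sub_eq_zero] using h0
    rwa [hta] at ht
  refine ⟨firstCoords a, fun x y hxy => ?_⟩
  simp only [Prod.mk.injEq] at hxy
  by_cases hne : x = y
  · rw [hne]
  obtain ⟨e, he, he0, hmir⟩ := exists_planeRefl_eq hn hne hxy.1 hxy.2
  rw [← hsymm e he he0 x, hmir]

lemma IsMinimizer.exists_ae_eq_radial {σ : ℝ} (hσ0 : 0 < σ) (hσ' : σ < 1)
    {u : EuclideanSpace ℝ (Fin n) → ℝ} (hu : IsMinimizer σ (halfSpace hn) u) :
    ∃ (a : EuclideanSpace ℝ (Fin (n - 1))) (v : ℝ → ℝ → ℝ),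
      ∀ᵐ x ∂(volume.restrict (halfSpace hn)), u x = v ‖firstCoords x - a‖ (lastCoord hn x) := by
  have hΩ : IsOpen (halfSpace hn) := isOpen_halfSpace hn
  have hp0 : 0 < critExp n σ := critExp_pos hn hσ'
  set p : ℝ≥0∞ := ENNReal.ofReal (critExp n σ) with hp
  have hp1 : 1 ≤ p := by
    rw [hp, ENNReal.one_le_ofReal]
    linarith [two_le_critExp hn hσ0 hσ']
  have hptop : p ≠ ⊤ := ENNReal.ofReal_ne_top
  -- a measurable representative of `u`, extended by zero to the whole space
  set U : EuclideanSpace ℝ (Fin n) → ℝ := (halfSpace hn).indicator (hu.1.1.mk u) with hU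
  have hUm : Measurable U := hu.1.1.measurable_mk.indicator hΩ.measurableSet
  have huU : u =ᵐ[volume.restrict (halfSpace hn)] U :=
    hu.1.1.ae_eq_mk.trans (indicator_ae_eq_restrict hΩ.measurableSet).symm
  have hmin : IsMinimizer σ (halfSpace hn) U := hu.congr_ae huU
  have hnorm : eLpNorm U p volume = eLpNorm U p (volume.restrict (halfSpace hn)) := by
    conv_lhs => rw [hU]
    rw [eLpNorm_indicator_eq_eLpNorm_restrict hΩ.measurableSet]
    exact eLpNorm_congr_ae (indicator_ae_eq_restrict hΩ.measurableSet).symm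
  have hpow : eLpNorm U p volume ^ critExp n σ = 1 := by
    rw [hnorm, ← critMass_eq_eLpNorm hp0, hmin.2.1]
  have hULp : MemLp U p volume := by
    refine ⟨hUm.aestronglyMeasurable, lt_top_iff_ne_top.2 fun h => ?_⟩
    rw [h, ENNReal.top_rpow_of_pos hp0] at hpow
    exact ENNReal.top_ne_one hpow
  have hU0 : ¬ U =ᵐ[volume] 0 := by
    intro h
    rw [eLpNorm_congr_ae h, eLpNorm_zero, ENNReal.zero_rpow_of_pos hp0] at hpow
    exact zero_ne_one hpow
  set W := preciseRep U with hW
  have hWU : W =ᵐ[volume] U := preciseRep_ae_eq (hULp.locallyIntegrable hp1)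
  have hexists : ∀ e : EuclideanSpace ℝ (Fin n), ‖e‖ = 1 → lastCoord hn e = 0 →
      ∃ t, ∀ x, W (planeRefl e t x) = W x := by
    intro e he he0
    have hout : ∀ t, ∀ x ∉ halfSpace hn, U x = 0 ∧ U (planeRefl e t x) = 0 := by
      intro t x hx
      refine ⟨Set.indicator_of_notMem hx _, Set.indicator_of_notMem ?_ _⟩
      rwa [← Set.mem_preimage, planeRefl_preimage_halfSpace hn he0]
    obtain ⟨t, ht⟩ := exists_planeRefl_ae_eq he hp1 hptop hUm hULp hU0 fun t => by
      refine (hmin.ae_le_or_ae_ge (t := t) hn hσ0 hσ' hΩ he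
        (planeRefl_preimage_halfSpace hn he0) hUm).imp (fun h => ?_) fun h => ?_
      all_goals
        rw [ae_restrict_iff' hΩ.measurableSet] at h
        filter_upwards [h] with x hx h0
        by_cases hxΩ : x ∈ halfSpace hn
        · exact hx hxΩ h0
        · rw [(hout t x hxΩ).1, (hout t x hxΩ).2]
    exact ⟨t, preciseRep_planeRefl he ht⟩
  have hper : ∀ v : EuclideanSpace ℝ (Fin n), (∀ x, W (x + v) = W x) → v = 0 := by
    intro v hv
    by_contra hne
    have hUper : ∀ᵐ x : EuclideanSpace ℝ (Fin n), U (x + v) = U x := by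
      filter_upwards [hWU, (measurePreserving_add_right volume v).quasiMeasurePreserving.ae hWU]
        with x h1 h2
      rw [← h1, ← h2, hv]
    have hz := ae_eq_zero_of_add_eq (f := fun x => ‖U x‖ₑ ^ p.toReal) (by fun_prop)
      (lintegral_rpow_enorm_lt_top_of_eLpNorm_lt_top (zero_lt_one.trans_le hp1).ne' hptop
        hULp.eLpNorm_lt_top).ne hne (hUper.mono fun x hx => by rw [hx])
    refine hU0 (hz.mono fun x hx => ?_)
    simpa [ENNReal.rpow_eq_zero_iff_of_pos
      (ENNReal.toReal_pos (zero_lt_one.trans_le hp1).ne' hptop)] using hx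
  obtain ⟨a, ha⟩ := exists_factorsThrough_norm_firstCoords_sub hn hexists hper
  refine ⟨a, fun r s => Function.extend
    (fun x => (‖firstCoords x - a‖, lastCoord hn x)) W 0 (r, s), ?_⟩
  filter_upwards [huU, ae_restrict_of_ae hWU] with x h1 h2
  rw [h1, ← h2]
  exact (ha.extend_apply 0 x).symm

end HalfSpace

end RegionalSobolev

end

theorem theorem1p3 (n : ℕ) (hn : 2 ≤ n) (σ : ℝ) (hσ : 1 / 2 < σ) (hσ' : σ < 1)
    (u : EuclideanSpace ℝ (Fin n) → ℝ)
    (hu : RegionalSobolev.IsMinimizer σ (RegionalSobolev.halfSpace hn) u) :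
    ∃ (a : EuclideanSpace ℝ (Fin (n - 1))) (v : ℝ → ℝ → ℝ),
      ∀ᵐ x ∂(volume.restrict (RegionalSobolev.halfSpace hn)),
        u x = v ‖RegionalSobolev.firstCoords x - a‖ (RegionalSobolev.lastCoord hn x) := by
  exact hu.exists_ae_eq_radial hn (by linarith) hσ'
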